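/- Setting. Let $\mathcal X=\{1,\dots,k\}$, let $Q$ be a strictly positive probability vector on $\mathcal X$, let $h:\mathcal X\to\mathbb R^d$, and write $A=[h(1)\cdots h(k)]$ and $\mathsf T=\{v\in\mathbb R^k:\sum_x v_x=0,\ Av=0\}$; assume $\mathsf T\neq\{0\}$. Let $\Theta\subset\mathbb R^p$ be measurable and $\alpha:\Theta\to\mathbb R^d$ continuous, such that for each $\theta\in\Theta$ the set $E_\theta=\{P: P(x)>0\ \forall x,\ \sum_xP(x)=1,\ \sum_x P(x)h(x)=\alpha(\theta)\}$ is non-empty. Let $P_\theta^*$ be the minimizer over $P\in E_\theta$ of $\sum_xP(x)\log\frac{P(x)}{Q(x)}$, let $H_\theta^*=\Pi_{\mathsf T}\,\mathrm{diag}(1/P_\theta^*)\,\Pi_{\mathsf T}$ regarded as an operator on $\mathsf T$ ($\Pi_{\mathsf T}$ the orthogonal projection onto $\mathsf T$), and let $\lambda_{\min}(H_\theta^*)$ be its smallest eigenvalue. Let $\theta_0$ be an interior point of $\Theta$ at which $\alpha$ is differentiable with injective derivative, and suppose that $\inf\{\|\alpha(\theta)-\alpha(\theta_0)\|:\theta\in\Theta,\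 \|\theta-\theta_0\|\ge\varepsilon\}>0$ for every $\varepsilon>0$. Let $\pi$ be a prior probability measure on $\Theta$ that has a positive continuous Lebesgue density on a neighbourhood of $\theta_0$. The BETEL posterior given $x_{1:n}\in\mathcal X^n$ is $$\pi(d\theta\mid x_{1:n})\ \propto\ \prod_{i=1}^nP_\theta^*(x_i)\ \pi(d\theta),$$ and the BETEL predictive law of $m$ future observations is $\mu_{n,m}^{\mathrm{BETEL}}=\int (P_\theta^*)^{\otimes m}\,\pi(d\theta\mid x_{1:n})$. Let $r_n=\sqrt{\dfrac{\log n}{n\,\lambda_{\min}(H_{\theta_0}^*)}}$. Observations. Let $X_1,X_2,\dots$ be i.i.d. in $\mathcal X$ with $\mathbb E[h(X_1)]=\alpha(\theta_0)$ (for example $X_i\sim Q$ if $Q\in E_{\theta_0}$). Corollary (Posterior concentration). The BETEL posterior is a well-defined probability measure for every sample, and the following hold. 1. For every $c>0$ there are constants $C,K>0$ such that, almost surely, for all sufficiently large $n$, $$\pi\big(\|\theta-\theta_0\|_2>C\,r_n\ \big|\ X_{1:n}\big)\le K n^{-c}.$$ 2. There is a constant $K>0$ such that, almost surely, for all sufficiently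 large $n$ and for every $m\ge 0$, $$\big\|\mu_{n,m}^{\mathrm{BETEL}}-(P_{\theta_0}^*)^{\otimes m}\big\|_{\mathrm{TV}}\le K\,m\,r_n,$$ where $\|\mu-\nu\|_{\mathrm{TV}}=\sup_B|\mu(B)-\nu(B)|$. With the same constants, both bounds also hold, for all sufficiently large $n$, simultaneously for all samples $x_{1:n}\in\mathcal X^n$ whose empirical measure $P_n$ lies in $E_{\theta_0}$ (hence under any law of the data conditioned on $P_n\in E_{\theta_0}$). The constants may depend on $Q,h,\alpha,\Theta,\theta_0,\pi$ and the law of $X_1$, but not on $n$ or $m$ or, beyond that, on the observed sample. -/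

import Mathlib

open MeasureTheory ProbabilityTheory Filter Topology

noncomputable section

namespace BETEL

/-- The open simplex of strictly positive probability vectors on `Fin k`. -/
def openSimplex (k : ℕ) : Set (Fin k → ℝ) :=
  {P | (∀ x, 0 < P x) ∧ ∑ x, P x = 1}

/-- The feasible set: strictly positive laws `P` with `E_P[h] = a`. -/
def feasible {k d : ℕ} (h : Fin k → EuclideanSpace ℝ (Fin d)) (a : EuclideanSpace ℝ (Fin d)) :
    Set (Fin k → ℝ) :=
  {P | P ∈ openSimplex k ∧ ∑ x, P x • h x = a}

/-- Kullback-Leibler divergence of laws on a finite set. -/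
def kl {k : ℕ} (P Q : Fin k → ℝ) : ℝ := ∑ x, P x * Real.log (P x / Q x)

open Classical in
/-- The information projection `argmin {kl P Q : P ∈ feasible h a}` of `Q`.
The value `Q` is a dummy, used only if there is no minimizer. -/
def infoProj {k d : ℕ} (Q : Fin k → ℝ) (h : Fin k → EuclideanSpace ℝ (Fin d))
    (a : EuclideanSpace ℝ (Fin d)) : Fin k → ℝ :=
  if H : ∃ P ∈ feasible h a, IsMinOn (fun P => kl P Q) (feasible h a) P then H.choose else Q

/-- The tangent space `{v : ∑ x, v x = 0, A v = 0}`, where `A` has the columns `h x`. -/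
def tangentSpace {k d : ℕ} (h : Fin k → EuclideanSpace ℝ (Fin d)) :
    Submodule ℝ (EuclideanSpace ℝ (Fin k)) where
  carrier := {v | ∑ x, v x = 0 ∧ ∑ x, v x • h x = 0}
  zero_mem' := by simp
  add_mem' := by
    rintro v w ⟨hv, hv'⟩ ⟨hw, hw'⟩
    constructor
    · simp [Finset.sum_add_distrib, hv, hw]
    · simp [add_smul, Finset.sum_add_distrib, hv', hw']
  smul_mem' := by
    rintro c v ⟨hv, hv'⟩
    constructor
    · simp [← Finset.mul_sum, hv]
    · simp [mul_smul, ← Finset.smul_sum, hv']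

/-- The projected Hessian `v ↦ Π_T (diag (1 / P) v)`, as an endomorphism of the tangent space. -/
def projHessian {k d : ℕ} (h : Fin k → EuclideanSpace ℝ (Fin d)) (P : Fin k → ℝ) :
    Module.End ℝ (tangentSpace h) :=
  (tangentSpace h).orthogonalProjectionOnto.toLinearMap ∘ₗ
    Matrix.toEuclideanLin (Matrix.diagonal fun x => 1 / P x) ∘ₗ (tangentSpace h).subtype

/-- The smallest eigenvalue of the projected Hessian. -/
def curvature {k d : ℕ} (h : Fin k → EuclideanSpace ℝ (Fin d)) (P : Fin k → ℝ) : ℝ :=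
  sInf {μ : ℝ | (projHessian h P).HasEigenvalue μ}

/-- The empirical measure of a sample. -/
def empirical {k n : ℕ} (x : Fin n → Fin k) : Fin k → ℝ :=
  fun y => ((Finset.univ.filter fun i => x i = y).card : ℝ) / n

/-- The law of `m` independent draws from `P`, as a mass function. -/
def iidLaw {k : ℕ} (P : Fin k → ℝ) (m : ℕ) : (Fin m → Fin k) → ℝ :=
  fun y => ∏ j, P (y j)

/-- Total variation distance (supremum over events) of mass functions on a finite set. -/
def tvDist {ι : Type*} (μ ν : ι → ℝ) : ℝ :=
  ⨆ A : Finset ι, |∑ y ∈ A, μ y - ∑ y ∈ A, ν y|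

variable {k d p : ℕ}

/-- The posterior law of the parameter: the prior reweighted by the likelihood
`∏ i, P*_θ (x i)` and normalized, where `P*_θ` is the information projection of `Q` onto
`{P : E_P[h] = α θ}`. -/
def posterior (Q : Fin k → ℝ) (h : Fin k → EuclideanSpace ℝ (Fin d))
    (α : EuclideanSpace ℝ (Fin p) → EuclideanSpace ℝ (Fin d))
    (prior : Measure (EuclideanSpace ℝ (Fin p))) {n : ℕ} (x : Fin n → Fin k) :
    Measure (EuclideanSpace ℝ (Fin p)) :=
  (∫⁻ θ, ENNReal.ofReal (iidLaw (infoProj Q h (α θ)) n x) ∂prior)⁻¹ •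
    prior.withDensity fun θ => ENNReal.ofReal (iidLaw (infoProj Q h (α θ)) n x)

/-- The posterior predictive law of `m` future observations, as a mass function. -/
def predictive (Q : Fin k → ℝ) (h : Fin k → EuclideanSpace ℝ (Fin d))
    (α : EuclideanSpace ℝ (Fin p) → EuclideanSpace ℝ (Fin d))
    (prior : Measure (EuclideanSpace ℝ (Fin p))) {n : ℕ} (x : Fin n → Fin k) (m : ℕ) :
    (Fin m → Fin k) → ℝ :=
  fun y => ∫ θ, iidLaw (infoProj Q h (α θ)) m y ∂(posterior Q h α prior x)

/-- The rate `√(log n / (n lam))`. -/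
def rate (n : ℕ) (lam : ℝ) : ℝ := Real.sqrt (Real.log n / (n * lam))

end BETEL

end

/-!
Write `P*_a` for the information projection of `Q` onto the laws with moment `a`, and `P*_θ` for
`P*_a` at `a = α θ`. The log-density of `P*_a` with respect to `Q` is a constant plus a linear
functional of `h`, so that the Pythagorean identity
`KL(S ‖ P*_θ) = KL(S ‖ P*_m) + KL(P*_m ‖ P*_θ)` holds for every law `S` with moment `m`. Applied to
the empirical measure it says that the likelihood of `P*_θ` is the maximal one times
`exp (-n KL(P*_m ‖ P*_θ))`, where `m` is the empirical moment. The divergence between two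
projections is locally comparable to the squared distance of their moments: from below by a
Pinsker-type inequality, from above because a small change of the moment is absorbed by a small
change of the law, and the projection minimizes the divergence.

By Hoeffding's inequality and the Borel-Cantelli lemma, `m` is eventually within `O(r_n)` of
`α θ₀`, and this is the only property of the sample that matters. On the ball of radius `r_n`
around `θ₀`, of prior mass at least `b n ^ (-p / 2)`, the relative likelihood is then at least
`n ^ (-e)` for some fixed `e`; beyond distance `C r_n` it is at most `n ^ (-e - p / 2 - c)` for `C`
large. This is posterior concentration. The predictive bound follows because the projection is
Lipschitz in the moment near `α θ₀`, the product law of `m` draws is `m`-Lipschitz in its factor,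
and the far parameters contribute a mass `n ^ (-1 / 2)`, which is at most `r_n`.
-/

namespace BETEL

section KullbackLeibler

open InformationTheory

variable {k : ℕ} {P Q R : Fin k → ℝ}

lemma openSimplex_subset_stdSimplex : openSimplex k ⊆ stdSimplex ℝ (Fin k) :=
  fun _ hP => ⟨fun x => (hP.1 x).le, hP.2⟩

lemma exists_pos_le (hP : ∀ x, 0 < P x) : ∃ δ > 0, ∀ x, δ ≤ P x := by
  rcases isEmpty_or_nonempty (Fin k) with _ | _
  · exact ⟨1, one_pos, fun x => isEmptyElim x⟩
  · obtain ⟨x, hx⟩ := Finite.exists_min P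
    exact ⟨P x, hP x, hx⟩

lemma sq_sqrt_sub_one_le_klFun {x : ℝ} (hx : 0 ≤ x) : (√x - 1) ^ 2 ≤ klFun x := by
  have klFun_sq : klFun x = 2 * √x * klFun √x + (√x - 1) ^ 2 := by
    simp only [klFun_apply, Real.log_sqrt hx]
    linear_combination (1 - Real.log x) * Real.sq_sqrt hx
  have : 0 ≤ 2 * √x * klFun √x := by
    have := klFun_nonneg (Real.sqrt_nonneg x)
    positivity
  linarith

lemma klFun_le_sq_sub_one {x : ℝ} (hx : 0 ≤ x) : klFun x ≤ (x - 1) ^ 2 := by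
  rcases hx.eq_or_lt with rfl | hx
  · simp [klFun_apply]
  · rw [klFun_apply]
    nlinarith [Real.log_le_sub_one_of_pos hx]

lemma kl_eq_sum_mul_klFun (hP : P ∈ stdSimplex ℝ (Fin k)) (hR : R ∈ openSimplex k) :
    kl P R = ∑ x, R x * klFun (P x / R x) := by
  have hterm (x : Fin k) :
      R x * klFun (P x / R x) = P x * Real.log (P x / R x) + R x - P x := by
    have := (hR.1 x).ne'
    rw [klFun_apply]
    field_simp
  simp [hterm, Finset.sum_add_distrib, hP.2, hR.2, kl]

lemma mul_klFun_div_le_kl (hP : P ∈ stdSimplex ℝ (Fin k)) (hR : R ∈ openSimplex k) (x : Fin k) :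
    R x * klFun (P x / R x) ≤ kl P R := by
  rw [kl_eq_sum_mul_klFun hP hR]
  exact Finset.single_le_sum (f := fun y => R y * klFun (P y / R y))
    (fun y _ => mul_nonneg (hR.1 y).le (klFun_nonneg (div_nonneg (hP.1 y) (hR.1 y).le)))
    (Finset.mem_univ x)

lemma kl_nonneg (hP : P ∈ stdSimplex ℝ (Fin k)) (hR : R ∈ openSimplex k) : 0 ≤ kl P R := by
  rw [kl_eq_sum_mul_klFun hP hR]
  exact Finset.sum_nonneg fun x _ =>
    mul_nonneg (hR.1 x).le (klFun_nonneg (div_nonneg (hP.1 x) (hR.1 x).le))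

lemma sq_sub_div_four_le_mul_klFun_div {p r : ℝ} (hp0 : 0 ≤ p) (hp1 : p ≤ 1) (hr0 : 0 < r)
    (hr1 : r ≤ 1) : (p - r) ^ 2 / 4 ≤ r * klFun (p / r) := by
  have hellinger : r * (√(p / r) - 1) ^ 2 = (√p - √r) ^ 2 := by
    have : 0 < √r := Real.sqrt_pos.2 hr0
    rw [Real.sqrt_div hp0]
    nth_rewrite 1 [← Real.sq_sqrt hr0.le]
    field_simp
  have factor : p - r = (√p - √r) * (√p + √r) := by
    linear_combination -Real.sq_sqrt hp0 + Real.sq_sqrt hr0.le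
  have sum_sq_le : (√p + √r) ^ 2 ≤ 4 := by
    nlinarith [Real.sqrt_nonneg p, Real.sqrt_nonneg r, Real.sqrt_le_one.2 hp1,
      Real.sqrt_le_one.2 hr1]
  calc (p - r) ^ 2 / 4 = (√p - √r) ^ 2 * (√p + √r) ^ 2 / 4 := by rw [factor, mul_pow]
    _ ≤ (√p - √r) ^ 2 := by nlinarith [mul_le_mul_of_nonneg_left sum_sq_le (sq_nonneg (√p - √r))]
    _ = r * (√(p / r) - 1) ^ 2 := hellinger.symm
    _ ≤ r * klFun (p / r) := by
      gcongr
      exact sq_sqrt_sub_one_le_klFun (by positivity)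

lemma sq_norm_sub_le_kl (hP : P ∈ stdSimplex ℝ (Fin k)) (hR : R ∈ openSimplex k) :
    ‖P - R‖ ^ 2 / 4 ≤ kl P R := by
  have hkl := kl_nonneg hP hR
  suffices ‖P - R‖ ≤ √(4 * kl P R) by
    linarith [(Real.le_sqrt (norm_nonneg _) (by positivity)).1 this]
  refine (pi_norm_le_iff_of_nonneg (Real.sqrt_nonneg _)).2 fun x => Real.le_sqrt_of_sq_le ?_
  rw [Real.norm_eq_abs, sq_abs, Pi.sub_apply]
  linarith [mul_klFun_div_le_kl hP hR x, sq_sub_div_four_le_mul_klFun_div (hP.1 x)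
    (mem_Icc_of_mem_stdSimplex hP x).2 (hR.1 x)
    (mem_Icc_of_mem_stdSimplex (openSimplex_subset_stdSimplex hR) x).2]

lemma kl_le_sq_norm_sub (hP : P ∈ stdSimplex ℝ (Fin k)) (hR : R ∈ openSimplex k)
    {δ : ℝ} (hδ : 0 < δ) (hδR : ∀ x, δ ≤ R x) : kl P R ≤ k / δ * ‖P - R‖ ^ 2 := by
  have hterm (x : Fin k) : R x * klFun (P x / R x) ≤ ‖P - R‖ ^ 2 / δ := by
    have hRx := hR.1 x
    calc R x * klFun (P x / R x) ≤ R x * (P x / R x - 1) ^ 2 := by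
          gcongr
          exact klFun_le_sq_sub_one (div_nonneg (hP.1 x) hRx.le)
      _ = |(P - R) x| ^ 2 / R x := by rw [sq_abs, Pi.sub_apply]; field_simp
      _ ≤ ‖P - R‖ ^ 2 / δ := by
          gcongr
          exacts [norm_le_pi_norm (P - R) x, hδR x]
  rw [kl_eq_sum_mul_klFun hP hR]
  refine (Finset.sum_le_sum fun x _ => hterm x).trans_eq ?_
  rw [Finset.sum_const, Finset.card_univ, Fintype.card_fin, nsmul_eq_mul]
  ring

lemma mul_log_div {q : ℝ} (hq : q ≠ 0) (t : ℝ) :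
    t * Real.log (t / q) = t * Real.log t - t * Real.log q := by
  rcases eq_or_ne t 0 with rfl | ht
  · simp
  · rw [Real.log_div ht hq, mul_sub]

lemma kl_sub_kl (hP : ∀ x, 0 < P x) (hQ : ∀ x, 0 < Q x) (S : Fin k → ℝ) :
    kl S Q - kl S P = ∑ x, S x * Real.log (P x / Q x) := by
  simp only [kl, ← Finset.sum_sub_distrib, mul_log_div (hP _).ne', mul_log_div (hQ _).ne',
    Real.log_div (hP _).ne' (hQ _).ne']
  exact Finset.sum_congr rfl fun x _ => by ring

lemma continuous_kl (hQ : ∀ x, Q x ≠ 0) : Continuous fun P => kl P Q := by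
  simp only [kl, mul_log_div (hQ _)]
  exact continuous_finsetSum _ fun x _ =>
    (Real.continuous_mul_log.comp (continuous_apply x)).sub (by fun_prop)

lemma hasDerivAt_kl_add_smul (hP : ∀ x, 0 < P x) (hQ : ∀ x, 0 < Q x) (v : Fin k → ℝ) :
    HasDerivAt (fun t : ℝ => kl (P + t • v) Q)
      (∑ x, (v x * Real.log (P x / Q x) + v x)) 0 := by
  refine HasDerivAt.fun_sum fun x _ => ?_
  have hPx := hP x
  have hQx := hQ x
  have hline : HasDerivAt (fun t : ℝ => (P + t • v) x) (v x) 0 := by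
    simpa using ((hasDerivAt_id (0 : ℝ)).mul_const (v x)).const_add (P x)
  refine (hline.mul ((hline.div_const (Q x)).log ?_)).congr_deriv ?_
  · simpa using ⟨hPx.ne', hQx.ne'⟩
  · simp only [zero_smul, add_zero]
    field_simp

end KullbackLeibler

section Projection

lemma mul_log_div_convexComb_le {q u r t : ℝ} (hq : q ≠ 0) (hu : 0 ≤ u) (hr : 0 ≤ r)
    (ht0 : 0 ≤ t) (ht1 : t ≤ 1) :
    ((1 - t) * u + t * r) * Real.log (((1 - t) * u + t * r) / q) ≤
      (1 - t) * (u * Real.log (u / q)) + t * (r * Real.log (r / q)) := by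
  have := Real.convexOn_mul_log.2 (Set.mem_Ici.2 hu) (Set.mem_Ici.2 hr)
    (sub_nonneg.2 ht1) ht0 (by ring)
  simp only [smul_eq_mul] at this
  simp only [mul_log_div hq]
  linarith

variable {k d : ℕ} {P Q R : Fin k → ℝ}

lemma kl_convexComb_le (hQ : ∀ x, 0 < Q x) (hP : ∀ x, 0 ≤ P x) (hR : ∀ x, 0 ≤ R x) {z : Fin k}
    (hPz : P z = 0) (hRz : 0 < R z) {t : ℝ} (ht0 : 0 < t) (ht1 : t ≤ 1) :
    kl ((1 - t) • P + t • R) Q ≤ (1 - t) * kl P Q + t * kl R Q + t * Real.log t * R z := by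
  have hterm (x : Fin k) : ((1 - t) • P + t • R) x * Real.log (((1 - t) • P + t • R) x / Q x) ≤
      (1 - t) * (P x * Real.log (P x / Q x)) + t * (R x * Real.log (R x / Q x))
        + if x = z then t * Real.log t * R z else 0 := by
    simp only [Pi.add_apply, Pi.smul_apply, smul_eq_mul]
    split_ifs with hx
    · subst hx
      rw [hPz, mul_zero, zero_add, mul_div_assoc,
        Real.log_mul ht0.ne' (div_pos hRz (hQ x)).ne']
      apply le_of_eq
      ring
    · rw [add_zero]
      exact mul_log_div_convexComb_le (hQ x).ne' (hP x) (hR x) ht0.le ht1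
  refine (Finset.sum_le_sum fun x _ => hterm x).trans_eq ?_
  simp [kl, Finset.sum_add_distrib, Finset.mul_sum]

/- Moving from `P` towards `R` by `t` changes the divergence by `O(t)` in the coordinates where `P`
is positive, and by a multiple of `t log t`, which is more negative, where `P` vanishes. -/
lemma pos_of_isMinOn_kl (hQ : ∀ x, 0 < Q x) {s : Set (Fin k → ℝ)} (hs : Convex ℝ s)
    (hs0 : ∀ P ∈ s, ∀ x, 0 ≤ P x) (hP : P ∈ s) (hmin : IsMinOn (fun P => kl P Q) s P)
    (hR : R ∈ s) {z : Fin k} (hRz : 0 < R z) : 0 < P z := by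
  refine (hs0 P hP z).lt_of_ne' fun hPz => ?_
  set b := |kl R Q - kl P Q| / R z + 1 with hb
  have hmixed := (hmin (hs hP hR (sub_nonneg.2 (Real.exp_le_one_iff.2
    (neg_nonpos.2 (by positivity : 0 ≤ b)))) (Real.exp_pos _).le (sub_add_cancel _ _))).trans
    (kl_convexComb_le hQ (hs0 P hP) (hs0 R hR) hPz hRz (Real.exp_pos (-b))
      (Real.exp_le_one_iff.2 (neg_nonpos.2 (by positivity))))
  rw [Real.log_exp] at hmixed
  have hgain : 0 ≤ kl R Q - kl P Q - b * R z :=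
    nonneg_of_mul_nonneg_right (by linarith) (Real.exp_pos (-b))
  have hbR : b * R z = |kl R Q - kl P Q| + R z := by rw [hb]; field_simp
  linarith [le_abs_self (kl R Q - kl P Q)]

/-- The moments `E_P[h]` of the strictly positive laws `P`, that is, the constraints for which the
information projection is a genuine minimizer. -/
def feasibleMoments (h : Fin k → EuclideanSpace ℝ (Fin d)) : Set (EuclideanSpace ℝ (Fin d)) :=
  {a | (feasible h a).Nonempty}

variable {h : Fin k → EuclideanSpace ℝ (Fin d)} {a b : EuclideanSpace ℝ (Fin d)}

lemma exists_isMinOn_kl (hQ : ∀ x, 0 < Q x) (ha : a ∈ feasibleMoments h) :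
    ∃ P ∈ feasible h a, IsMinOn (fun P => kl P Q) (feasible h a) P := by
  obtain ⟨R, hR⟩ := ha
  set s := stdSimplex ℝ (Fin k) ∩ Fintype.linearCombination ℝ h ⁻¹' {a}
  have hsub : feasible h a ⊆ s := fun P hP => ⟨openSimplex_subset_stdSimplex hP.1, hP.2⟩
  have hs_compact : IsCompact s := (isCompact_stdSimplex ℝ (Fin k)).inter_right
    (isClosed_singleton.preimage (LinearMap.continuous_of_finiteDimensional _))
  have hs_convex : Convex ℝ s :=
    (convex_stdSimplex ℝ (Fin k)).inter ((convex_singleton a).linear_preimage _)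
  obtain ⟨P, hP, hmin⟩ := hs_compact.exists_isMinOn ⟨R, hsub hR⟩
    (continuous_kl fun x => (hQ x).ne').continuousOn
  exact ⟨P, ⟨⟨fun x => pos_of_isMinOn_kl hQ hs_convex (fun P hP => hP.1.1) hP hmin (hsub hR)
    (hR.1.1 x), hP.1.2⟩, hP.2⟩, hmin.on_subset hsub⟩

lemma infoProj_mem_feasible (hQ : ∀ x, 0 < Q x) (ha : a ∈ feasibleMoments h) :
    infoProj Q h a ∈ feasible h a := by
  rw [infoProj, dif_pos (exists_isMinOn_kl hQ ha)]
  exact (exists_isMinOn_kl hQ ha).choose_spec.1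

lemma isMinOn_infoProj (hQ : ∀ x, 0 < Q x) (ha : a ∈ feasibleMoments h) :
    IsMinOn (fun P => kl P Q) (feasible h a) (infoProj Q h a) := by
  rw [infoProj, dif_pos (exists_isMinOn_kl hQ ha)]
  exact (exists_isMinOn_kl hQ ha).choose_spec.2

lemma infoProj_mem_openSimplex (hQ : Q ∈ openSimplex k) (h : Fin k → EuclideanSpace ℝ (Fin d))
    (a : EuclideanSpace ℝ (Fin d)) : infoProj Q h a ∈ openSimplex k := by
  rw [infoProj]
  split_ifs with hmin
  · exact hmin.choose_spec.1.1
  · exact hQ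

lemma eventually_add_smul_mem_feasible (hP : P ∈ feasible h a) {v : Fin k → ℝ}
    (hv : ∑ x, v x = 0) (hv' : ∑ x, v x • h x = 0) :
    ∀ᶠ t : ℝ in 𝓝 0, P + t • v ∈ feasible h a := by
  have hpos : ∀ᶠ t : ℝ in 𝓝 0, ∀ x, 0 < (P + t • v) x := by
    refine eventually_all.2 fun x => ?_
    have hline : Continuous fun t : ℝ => (P + t • v) x := by fun_prop
    exact hline.continuousAt.eventually_const_lt (by simpa using hP.1.1 x)
  filter_upwards [hpos] with t ht
  refine ⟨⟨ht, ?_⟩, ?_⟩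
  · simp [Finset.sum_add_distrib, ← Finset.mul_sum, hv, hP.1.2]
  · simp [add_smul, mul_smul, Finset.sum_add_distrib, ← Finset.smul_sum, hP.2, hv']

lemma sum_mul_log_infoProj_eq_zero (hQ : ∀ x, 0 < Q x) (ha : a ∈ feasibleMoments h)
    {v : Fin k → ℝ} (hv : ∑ x, v x = 0) (hv' : ∑ x, v x • h x = 0) :
    ∑ x, v x * Real.log (infoProj Q h a x / Q x) = 0 := by
  have hP := infoProj_mem_feasible hQ ha
  have hlocal : IsLocalMin (fun t : ℝ => kl (infoProj Q h a + t • v) Q) 0 := by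
    filter_upwards [eventually_add_smul_mem_feasible hP hv hv'] with t ht
    simpa using isMinOn_infoProj hQ ha ht
  have hcritical := hlocal.hasDerivAt_eq_zero (hasDerivAt_kl_add_smul hP.1.1 hQ v)
  rwa [Finset.sum_add_distrib, hv, add_zero] at hcritical

lemma sum_mul_log_infoProj_congr (hQ : ∀ x, 0 < Q x) (ha : a ∈ feasibleMoments h)
    {S T : Fin k → ℝ} (hST : ∑ x, S x = ∑ x, T x) (hST' : ∑ x, S x • h x = ∑ x, T x • h x) :
    ∑ x, S x * Real.log (infoProj Q h a x / Q x) =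
      ∑ x, T x * Real.log (infoProj Q h a x / Q x) := by
  have := sum_mul_log_infoProj_eq_zero hQ ha (v := S - T) (by simp [hST])
    (by simp [sub_smul, hST'])
  simpa [sub_mul, sub_eq_zero] using this

/- The logarithmic density of one projection with respect to another is affine in `h`: the
projections form an exponential family, for which the Pythagorean identity holds. -/
lemma kl_eq_kl_add_kl_infoProj (hQ : ∀ x, 0 < Q x) (ha : a ∈ feasibleMoments h)
    (hb : b ∈ feasibleMoments h) {S : Fin k → ℝ} (hS : ∑ x, S x = 1) (hS' : ∑ x, S x • h x = a) :
    kl S (infoProj Q h b) = kl S (infoProj Q h a) + kl (infoProj Q h a) (infoProj Q h b) := by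
  have hPa := infoProj_mem_feasible hQ ha
  have hPb := infoProj_mem_feasible hQ hb
  have hsum := hS.trans hPa.1.2.symm
  have hmoment := hS'.trans hPa.2.symm
  have hlog_a := sum_mul_log_infoProj_congr hQ ha hsum hmoment
  have hlog_b := sum_mul_log_infoProj_congr hQ hb hsum hmoment
  simp only [← kl_sub_kl hPa.1.1 hQ, ← kl_sub_kl hPb.1.1 hQ] at hlog_a hlog_b
  have hself : kl (infoProj Q h a) (infoProj Q h a) = 0 := by
    simp [kl, div_self (hPa.1.1 _).ne']
  linarith

end Projection

section Regularity

lemma exists_norm_le_mul_norm_map {E F : Type*} [NormedAddCommGroup E] [NormedSpace ℝ E]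
    [FiniteDimensional ℝ E] [NormedAddCommGroup F] [NormedSpace ℝ F] (T : E →ₗ[ℝ] F) :
    ∃ C > 0, ∀ v, ∃ w, T w = T v ∧ ‖w‖ ≤ C * ‖T v‖ := by
  have := FiniteDimensional.complete ℝ E
  have := FiniteDimensional.complete ℝ T.range
  obtain ⟨C, hC, hlift⟩ := T.rangeRestrict.toContinuousLinearMap.exists_preimage_norm_le
    T.surjective_rangeRestrict
  refine ⟨C, hC, fun v => ?_⟩
  obtain ⟨w, hw, hwC⟩ := hlift (T.rangeRestrict v)
  exact ⟨w, congrArg Subtype.val hw, hwC⟩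

lemma norm_sum_smul_sub_le {ι E : Type*} [Fintype ι] [NormedAddCommGroup E] [NormedSpace ℝ E]
    (h : ι → E) (P R : ι → ℝ) :
    ‖∑ x, P x • h x - ∑ x, R x • h x‖ ≤ (∑ x, ‖h x‖) * ‖P - R‖ := by
  rw [← Finset.sum_sub_distrib, Finset.sum_mul]
  refine (norm_sum_le _ _).trans (Finset.sum_le_sum fun x _ => ?_)
  rw [← sub_smul, norm_smul, mul_comm]
  gcongr
  exact norm_le_pi_norm (P - R) x

lemma eventually_nhdsWithin_mul_norm_sub_lt {E : Type*} [SeminormedAddCommGroup E] {s : Set E}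
    {a : E} (C : ℝ) {δ : ℝ} (hδ : 0 < δ) : ∀ᶠ b in 𝓝[s] a, C * ‖b - a‖ < δ := by
  have : Continuous fun b => C * ‖b - a‖ := by fun_prop
  exact nhdsWithin_le_nhds (this.continuousAt.eventually_lt_const (by simpa using hδ))

lemma sum_smul_mem_affineSpan {ι E : Type*} [Fintype ι] [AddCommGroup E] [Module ℝ E] (h : ι → E)
    {P : ι → ℝ} (hP : ∑ x, P x = 1) : ∑ x, P x • h x ∈ affineSpan ℝ (Set.range h) := by
  rw [← Finset.affineCombination_eq_linear_combination _ _ _ hP]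
  exact affineCombination_mem_affineSpan hP h

variable {k d : ℕ} {Q : Fin k → ℝ} {a₀ : EuclideanSpace ℝ (Fin d)}

lemma exists_mem_feasible_norm_sub_le (h : Fin k → EuclideanSpace ℝ (Fin d)) :
    ∃ C > 0, ∀ a ∈ affineSpan ℝ (Set.range h), ∀ b, ∀ P ∈ feasible h b, ∀ δ, (∀ x, δ ≤ P x) →
      C * ‖a - b‖ < δ → ∃ S ∈ feasible h a, ‖S - P‖ ≤ C * ‖a - b‖ := by
  let T := Fintype.linearCombination ℝ fun x => ((1 : ℝ), h x)
  have hT (v : Fin k → ℝ) : T v = (∑ x, v x, ∑ x, v x • h x) := by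
    simp [T, Fintype.linearCombination_apply, Prod.ext_iff, Prod.fst_sum, Prod.snd_sum]
  obtain ⟨C, hC, hlift⟩ := exists_norm_le_mul_norm_map T
  refine ⟨C, hC, fun a ha b P hP δ hδ hab => ?_⟩
  obtain ⟨W, hW, hWa⟩ := eq_affineCombination_of_mem_affineSpan_of_fintype ha
  rw [Finset.affineCombination_eq_linear_combination _ _ _ hW] at hWa
  obtain ⟨w, hw, hwC⟩ := hlift (W - P)
  have hTWP : T (W - P) = (0, a - b) := by
    simp [hT, sub_smul, hW, ← hWa, hP.1.2, hP.2]
  rw [hTWP] at hw hwC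
  obtain ⟨hw_sum, hw_moment⟩ := Prod.mk.inj ((hT w).symm.trans hw)
  have hw_norm : ‖w‖ ≤ C * ‖a - b‖ := by simpa [Prod.norm_def] using hwC
  refine ⟨P + w, ⟨⟨fun x => ?_, ?_⟩, ?_⟩, by simpa using hw_norm⟩
  · have := neg_le_of_abs_le ((norm_le_pi_norm w x).trans hw_norm)
    rw [Pi.add_apply]
    linarith [hδ x]
  · simp [Finset.sum_add_distrib, hP.1.2, hw_sum]
  · simp [add_smul, Finset.sum_add_distrib, hP.2, hw_moment]

variable {h : Fin k → EuclideanSpace ℝ (Fin d)}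

lemma feasibleMoments_subset_affineSpan :
    feasibleMoments h ⊆ affineSpan ℝ (Set.range h) := by
  rintro a ⟨P, hP, rfl⟩
  exact sum_smul_mem_affineSpan h hP.2

lemma feasibleMoments_mem_nhdsWithin_affineSpan (ha₀ : a₀ ∈ feasibleMoments h) :
    feasibleMoments h ∈ 𝓝[affineSpan ℝ (Set.range h)] a₀ := by
  obtain ⟨P, hP⟩ := ha₀
  obtain ⟨δ, hδ, hδP⟩ := exists_pos_le hP.1.1
  obtain ⟨C, -, hC⟩ := exists_mem_feasible_norm_sub_le h
  have hnear : ∀ᶠ a in 𝓝[affineSpan ℝ (Set.range h)] a₀, C * ‖a - a₀‖ < δ :=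
    eventually_nhdsWithin_mul_norm_sub_lt C hδ
  filter_upwards [hnear, self_mem_nhdsWithin] with a ha ha_span
  obtain ⟨S, hS, -⟩ := hC a ha_span a₀ P hP δ hδP ha
  exact ⟨S, hS⟩

lemma exists_kl_infoProj_le_of_le (hQ : ∀ x, 0 < Q x) (h : Fin k → EuclideanSpace ℝ (Fin d)) :
    ∃ C > 0, ∀ a ∈ feasibleMoments h, ∀ b ∈ feasibleMoments h, ∀ δ > 0,
      (∀ x, δ ≤ infoProj Q h b x) → C * ‖a - b‖ < δ →
      kl (infoProj Q h a) (infoProj Q h b) ≤ k / δ * (C * ‖a - b‖) ^ 2 := by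
  obtain ⟨C, hC, hlift⟩ := exists_mem_feasible_norm_sub_le h
  refine ⟨C, hC, fun a ha b hb δ hδ hδb hab => ?_⟩
  have hPa := infoProj_mem_feasible hQ ha
  have hPb := infoProj_mem_feasible hQ hb
  obtain ⟨S, hS, hSP⟩ := hlift a (feasibleMoments_subset_affineSpan ha) b _ hPb δ hδb hab
  have hS_simplex := openSimplex_subset_stdSimplex hS.1
  calc kl (infoProj Q h a) (infoProj Q h b) ≤ kl S (infoProj Q h b) := by
        rw [kl_eq_kl_add_kl_infoProj hQ ha hb hS.1.2 hS.2]
        exact le_add_of_nonneg_left (kl_nonneg hS_simplex hPa.1)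
    _ ≤ k / δ * ‖S - infoProj Q h b‖ ^ 2 := kl_le_sq_norm_sub hS_simplex hPb.1 hδ hδb
    _ ≤ k / δ * (C * ‖a - b‖) ^ 2 := by gcongr

lemma isBigO_infoProj_sub (hQ : ∀ x, 0 < Q x) (ha₀ : a₀ ∈ feasibleMoments h) :
    (fun a => infoProj Q h a - infoProj Q h a₀) =O[𝓝[feasibleMoments h] a₀] (· - a₀) := by
  have hP₀ := infoProj_mem_feasible hQ ha₀
  obtain ⟨δ, hδ, hδP⟩ := exists_pos_le hP₀.1.1
  obtain ⟨C, hC, hkl⟩ := exists_kl_infoProj_le_of_le hQ h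
  have hnear : ∀ᶠ a in 𝓝[feasibleMoments h] a₀, C * ‖a - a₀‖ < δ :=
    eventually_nhdsWithin_mul_norm_sub_lt C hδ
  refine Asymptotics.IsBigO.of_bound (2 * √(k / δ) * C) ?_
  filter_upwards [hnear, self_mem_nhdsWithin] with a ha_near ha
  have hlower := sq_norm_sub_le_kl
    (openSimplex_subset_stdSimplex (infoProj_mem_feasible hQ ha).1) hP₀.1
  have hupper := hkl a ha a₀ ha₀ δ hδ hδP ha_near
  refine abs_le_of_sq_le_sq' ?_ (by positivity) |>.2
  rw [mul_pow, mul_pow, mul_pow, Real.sq_sqrt (by positivity)]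
  linarith

lemma continuousOn_infoProj (hQ : ∀ x, 0 < Q x) :
    ContinuousOn (infoProj Q h) (feasibleMoments h) := fun a₀ ha₀ => by
  have hsub : Tendsto (· - a₀) (𝓝[feasibleMoments h] a₀) (𝓝 0) :=
    tendsto_nhdsWithin_of_tendsto_nhds (tendsto_sub_nhds_zero_iff.2 tendsto_id)
  exact tendsto_sub_nhds_zero_iff.1 ((isBigO_infoProj_sub hQ ha₀).trans_tendsto hsub)

lemma exists_kl_infoProj_le (hQ : ∀ x, 0 < Q x) (ha₀ : a₀ ∈ feasibleMoments h) :
    ∃ Γ > 0, ∃ t ∈ 𝓝[feasibleMoments h] a₀, ∀ a ∈ t, ∀ b ∈ t,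
      kl (infoProj Q h a) (infoProj Q h b) ≤ Γ * ‖a - b‖ ^ 2 := by
  obtain ⟨δ, hδ, hδP⟩ := exists_pos_le (infoProj_mem_feasible hQ ha₀).1.1
  obtain ⟨C, hC, hkl⟩ := exists_kl_infoProj_le_of_le hQ h
  have hmass : ∀ᶠ b in 𝓝[feasibleMoments h] a₀, ∀ x, δ / 2 ≤ infoProj Q h b x :=
    eventually_all.2 fun x =>
      ((continuous_apply x).continuousAt.comp_continuousWithinAt
        (continuousOn_infoProj hQ a₀ ha₀)).eventually_const_le
          ((half_lt_self hδ).trans_le (hδP x))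
  have hnear : ∀ᶠ a in 𝓝[feasibleMoments h] a₀, C * ‖a - a₀‖ < δ / 4 :=
    eventually_nhdsWithin_mul_norm_sub_lt C (by positivity)
  refine ⟨(k + 1) / (δ / 2) * C ^ 2, by positivity, _,
    (hmass.and hnear).and self_mem_nhdsWithin, ?_⟩
  rintro a ⟨⟨-, ha_near⟩, ha⟩ b ⟨⟨hb_mass, hb_near⟩, hb⟩
  have hab : C * ‖a - b‖ < δ / 2 := by
    have := mul_le_mul_of_nonneg_left (norm_sub_le_norm_sub_add_norm_sub a a₀ b) hC.le
    rw [norm_sub_rev a₀ b] at this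
    linarith
  refine (hkl a ha b hb (δ / 2) (half_pos hδ) hb_mass hab).trans ?_
  rw [mul_pow, ← mul_assoc]
  gcongr
  exact le_add_of_nonneg_right zero_le_one

lemma exists_sq_norm_sub_le_kl_infoProj (hQ : ∀ x, 0 < Q x)
    (h : Fin k → EuclideanSpace ℝ (Fin d)) :
    ∃ γ > 0, ∀ a ∈ feasibleMoments h, ∀ b ∈ feasibleMoments h,
      γ * ‖a - b‖ ^ 2 ≤ kl (infoProj Q h a) (infoProj Q h b) := by
  set H := ∑ x, ‖h x‖ + 1
  have hH : 0 < H := by positivity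
  refine ⟨1 / (4 * H ^ 2), by positivity, fun a ha b hb => ?_⟩
  have hPa := infoProj_mem_feasible hQ ha
  have hPb := infoProj_mem_feasible hQ hb
  have hmoment : ‖a - b‖ ≤ H * ‖infoProj Q h a - infoProj Q h b‖ := by
    have := norm_sum_smul_sub_le h (infoProj Q h a) (infoProj Q h b)
    rw [hPa.2, hPb.2] at this
    exact this.trans (by gcongr; exact le_add_of_nonneg_right zero_le_one)
  calc 1 / (4 * H ^ 2) * ‖a - b‖ ^ 2
      ≤ 1 / (4 * H ^ 2) * (H * ‖infoProj Q h a - infoProj Q h b‖) ^ 2 := by gcongr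
    _ = ‖infoProj Q h a - infoProj Q h b‖ ^ 2 / 4 := by field_simp
    _ ≤ _ := sq_norm_sub_le_kl (openSimplex_subset_stdSimplex hPa.1) hPb.1

end Regularity

section Curvature

variable {k d : ℕ} {h : Fin k → EuclideanSpace ℝ (Fin d)} {P : Fin k → ℝ}

lemma inner_projHessian (v w : tangentSpace h) :
    inner ℝ (projHessian h P v) w = ∑ x, 1 / P x * (v : EuclideanSpace ℝ (Fin k)) x *
      (w : EuclideanSpace ℝ (Fin k)) x := by
  have : inner ℝ (projHessian h P v) w =
      inner ℝ (Matrix.toEuclideanLin (Matrix.diagonal fun x => 1 / P x)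
        (v : EuclideanSpace ℝ (Fin k))) (w : EuclideanSpace ℝ (Fin k)) :=
    Submodule.inner_orthogonalProjectionOnto_eq_of_mem_right w _
  rw [this, PiLp.inner_apply]
  refine Finset.sum_congr rfl fun x _ => ?_
  simp [Matrix.toLpLin_apply, Matrix.mulVec_diagonal, mul_comm]

lemma isSymmetric_projHessian : (projHessian h P).IsSymmetric := fun v w => by
  rw [inner_projHessian, real_inner_comm, inner_projHessian]
  exact Finset.sum_congr rfl fun x _ => by ring

lemma inner_self_le_inner_projHessian (hP : P ∈ openSimplex k) (v : tangentSpace h) :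
    inner ℝ v v ≤ inner ℝ (projHessian h P v) v := by
  rw [inner_projHessian, Submodule.coe_inner, PiLp.inner_apply]
  refine Finset.sum_le_sum fun x _ => ?_
  have hPx : 1 ≤ 1 / P x := one_le_one_div (hP.1 x)
    (mem_Icc_of_mem_stdSimplex (openSimplex_subset_stdSimplex hP) x).2
  rw [mul_assoc]
  exact le_mul_of_one_le_left (mul_self_nonneg _) hPx

lemma one_le_curvature (hT : tangentSpace h ≠ ⊥) (hP : P ∈ openSimplex k) :
    1 ≤ curvature h P := by
  have : Nontrivial (tangentSpace h) := Submodule.nontrivial_iff_ne_bot.2 hT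
  refine le_csInf ⟨_, isSymmetric_projHessian.hasEigenvalue_iInf_of_finiteDimensional⟩
    fun μ hμ => ?_
  obtain ⟨v, hv⟩ := hμ.exists_hasEigenvector
  have hrayleigh := inner_self_le_inner_projHessian hP v
  rw [hv.apply_eq_smul, real_inner_smul_left] at hrayleigh
  exact le_of_mul_le_mul_right (by rwa [one_mul]) (real_inner_self_pos.2 hv.2)

end Curvature

section Likelihood

variable {k d n : ℕ} {P Q R : Fin k → ℝ}

lemma sum_empirical (hn : n ≠ 0) (x : Fin n → Fin k) : ∑ y, empirical x y = 1 := by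
  have hcard := Finset.card_eq_sum_card_fiberwise (f := x) (s := Finset.univ) (t := Finset.univ)
    (by simp)
  simp only [empirical, ← Finset.sum_div]
  rw [← Nat.cast_sum, ← hcard]
  simp [hn]

lemma sum_comp_eq_mul_sum_empirical (x : Fin n → Fin k) (g : Fin k → ℝ) :
    ∑ i, g (x i) = n * ∑ y, empirical x y * g y := by
  rcases eq_or_ne n 0 with rfl | hn
  · simp
  · rw [← Finset.sum_fiberwise_of_maps_to (s := Finset.univ) (t := Finset.univ) (g := x)
      (f := fun i => g (x i)) (by simp), Finset.mul_sum]
    refine Finset.sum_congr rfl fun y _ => ?_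
    rw [Finset.sum_congr rfl (g := fun _ => g y) (by simp +contextual), Finset.sum_const,
      empirical, nsmul_eq_mul]
    field_simp

/-- The moment `E_{P_n}[h]` of the empirical measure `P_n` of a sample. -/
noncomputable def empiricalMoment (h : Fin k → EuclideanSpace ℝ (Fin d)) (x : Fin n → Fin k) :
    EuclideanSpace ℝ (Fin d) :=
  ∑ y, empirical x y • h y

lemma iidLaw_eq_exp (hP : ∀ x, 0 < P x) (x : Fin n → Fin k) :
    iidLaw P n x = Real.exp (∑ i, Real.log (P (x i))) := by
  rw [Real.exp_sum]
  exact Finset.prod_congr rfl fun i _ => (Real.exp_log (hP _)).symm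

lemma iidLaw_eq_mul_exp (hP : ∀ x, 0 < P x) (hR : ∀ x, 0 < R x) (x : Fin n → Fin k) :
    iidLaw P n x =
      iidLaw R n x * Real.exp (n * (kl (empirical x) R - kl (empirical x) P)) := by
  rw [kl_sub_kl hP hR, ← sum_comp_eq_mul_sum_empirical x fun y => Real.log (P y / R y),
    iidLaw_eq_exp hP, iidLaw_eq_exp hR, ← Real.exp_add, ← Finset.sum_add_distrib]
  congr 1
  exact Finset.sum_congr rfl fun i _ => by rw [Real.log_div (hP _).ne' (hR _).ne']; ring

/- By the Pythagorean identity the projection onto the empirical moment is the maximum likelihood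
estimator, and it measures the loss of likelihood of every other projection. -/
lemma iidLaw_infoProj_eq_mul_exp (hQ : ∀ x, 0 < Q x) {h : Fin k → EuclideanSpace ℝ (Fin d)}
    {a : EuclideanSpace ℝ (Fin d)} (ha : a ∈ feasibleMoments h) (hn : n ≠ 0) {x : Fin n → Fin k}
    (hx : empiricalMoment h x ∈ feasibleMoments h) :
    iidLaw (infoProj Q h a) n x = iidLaw (infoProj Q h (empiricalMoment h x)) n x *
      Real.exp (-(n * kl (infoProj Q h (empiricalMoment h x)) (infoProj Q h a))) := by
  rw [iidLaw_eq_mul_exp (infoProj_mem_feasible hQ ha).1.1 (infoProj_mem_feasible hQ hx).1.1,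
    kl_eq_kl_add_kl_infoProj hQ hx ha (sum_empirical hn x) rfl]
  ring_nf

lemma iidLaw_pos (hP : ∀ x, 0 < P x) (x : Fin n → Fin k) : 0 < iidLaw P n x :=
  Finset.prod_pos fun _ _ => hP _

lemma iidLaw_nonneg (hP : P ∈ stdSimplex ℝ (Fin k)) (x : Fin n → Fin k) : 0 ≤ iidLaw P n x :=
  Finset.prod_nonneg fun _ _ => hP.1 _

lemma iidLaw_le_one (hP : P ∈ stdSimplex ℝ (Fin k)) (x : Fin n → Fin k) : iidLaw P n x ≤ 1 :=
  Finset.prod_le_one (fun _ _ => hP.1 _) fun _ _ => (mem_Icc_of_mem_stdSimplex hP _).2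

lemma iidLaw_cons (P : Fin k → ℝ) (z : Fin k) (x : Fin n → Fin k) :
    iidLaw P (n + 1) (Fin.cons z x : Fin (n + 1) → Fin k) = P z * iidLaw P n x := by
  simp [iidLaw, Fin.prod_univ_succ]

lemma sum_iidLaw (hP : ∑ x, P x = 1) : ∑ x, iidLaw P n x = 1 := by
  simp only [iidLaw]
  rw [← Fintype.prod_sum fun (_ : Fin n) (x : Fin k) => P x]
  simp [hP]

lemma sum_pi_fin_succ {ι M : Type*} [Fintype ι] [AddCommMonoid M] (F : (Fin (n + 1) → ι) → M) :
    ∑ y, F y = ∑ z, ∑ y, F (Fin.cons z y) := by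
  rw [← (Fin.consEquiv fun _ : Fin (n + 1) => ι).sum_comp, Fintype.sum_prod_type]
  rfl

lemma abs_mul_sub_mul_le {a a' b b' : ℝ} (ha : 0 ≤ a) (hb' : 0 ≤ b') :
    |a * b - a' * b'| ≤ a * |b - b'| + |a - a'| * b' := by
  calc |a * b - a' * b'| = |a * (b - b') + (a - a') * b'| := by ring_nf
    _ ≤ |a * (b - b')| + |(a - a') * b'| := abs_add_le _ _
    _ = a * |b - b'| + |a - a'| * b' := by rw [abs_mul, abs_mul, abs_of_nonneg ha,
      abs_of_nonneg hb']

lemma sum_abs_iidLaw_sub_le (hP : P ∈ stdSimplex ℝ (Fin k)) (hR : R ∈ stdSimplex ℝ (Fin k))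
    (m : ℕ) : ∑ y, |iidLaw P m y - iidLaw R m y| ≤ m * ∑ x, |P x - R x| := by
  induction m with
  | zero => simp [iidLaw]
  | succ m ih =>
    rw [sum_pi_fin_succ]
    simp only [iidLaw_cons]
    calc ∑ z, ∑ y, |P z * iidLaw P m y - R z * iidLaw R m y|
        ≤ ∑ z, ∑ y, (P z * |iidLaw P m y - iidLaw R m y| + |P z - R z| * iidLaw R m y) := by
          gcongr with z _ y
          exact abs_mul_sub_mul_le (hP.1 z) (iidLaw_nonneg hR y)
      _ = ∑ y, |iidLaw P m y - iidLaw R m y| + ∑ x, |P x - R x| := by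
          simp only [Finset.sum_add_distrib, ← Finset.mul_sum, ← Finset.sum_mul, hP.2,
            sum_iidLaw hR.2, one_mul, mul_one]
      _ ≤ m * ∑ x, |P x - R x| + ∑ x, |P x - R x| := by gcongr
      _ = (m + 1 : ℕ) * ∑ x, |P x - R x| := by push_cast; ring

end Likelihood

section Mixture

variable {E : Type*} [MeasurableSpace E] {μ ν : Measure E}

lemma isProbabilityMeasure_inv_smul_withDensity {g : E → ENNReal} (hg0 : ∫⁻ θ, g θ ∂μ ≠ 0)
    (hg : ∫⁻ θ, g θ ∂μ ≠ ⊤) :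
    IsProbabilityMeasure ((∫⁻ θ, g θ ∂μ)⁻¹ • μ.withDensity g) := by
  refine ⟨?_⟩
  rw [Measure.smul_apply, withDensity_apply _ MeasurableSet.univ, setLIntegral_univ, smul_eq_mul]
  exact ENNReal.inv_mul_cancel hg0 hg

lemma inv_smul_withDensity_apply_le [IsProbabilityMeasure μ] {g : E → ENNReal} {A B : Set E}
    (hA : MeasurableSet A) (hB : MeasurableSet B) {u l : ENNReal}
    (hu : ∀ᵐ θ ∂μ, θ ∈ A → g θ ≤ u) (hl : ∀ θ ∈ B, l ≤ g θ) :
    ((∫⁻ θ, g θ ∂μ)⁻¹ • μ.withDensity g) A ≤ u / (l * μ B) := by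
  have hnum : ∫⁻ θ in A, g θ ∂μ ≤ u := by
    calc ∫⁻ θ in A, g θ ∂μ ≤ ∫⁻ _ in A, u ∂μ :=
          setLIntegral_mono_ae measurable_const.aemeasurable hu
      _ ≤ u := by
          rw [setLIntegral_const]
          exact mul_le_of_le_one_right' prob_le_one
  have hden : l * μ B ≤ ∫⁻ θ, g θ ∂μ := by
    calc l * μ B = ∫⁻ _ in B, l ∂μ := (setLIntegral_const _ _).symm
      _ ≤ ∫⁻ θ in B, g θ ∂μ := setLIntegral_mono' hB hl
      _ ≤ ∫⁻ θ, g θ ∂μ := setLIntegral_le_lintegral _ _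
  rw [Measure.smul_apply, withDensity_apply _ hA, smul_eq_mul, mul_comm, ← div_eq_mul_inv]
  exact ENNReal.div_le_div hnum hden

lemma tvDist_integral_le [IsProbabilityMeasure ν] {ι : Type*} [Fintype ι] {F : E → ι → ℝ}
    (hF : ∀ y, Integrable (fun θ => F θ y) ν) (μ₀ : ι → ℝ) :
    tvDist (fun y => ∫ θ, F θ y ∂ν) μ₀ ≤ ∫ θ, ∑ y, |F θ y - μ₀ y| ∂ν := by
  have hF_sub (y : ι) : Integrable (fun θ => F θ y - μ₀ y) ν :=
    (hF y).sub' (integrable_const _)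
  refine ciSup_le fun A => ?_
  have hevent : ∑ y ∈ A, ∫ θ, F θ y ∂ν - ∑ y ∈ A, μ₀ y =
      ∫ θ, ∑ y ∈ A, (F θ y - μ₀ y) ∂ν := by
    rw [integral_finsetSum _ fun y _ => hF_sub y, ← Finset.sum_sub_distrib]
    refine Finset.sum_congr rfl fun y _ => ?_
    rw [integral_sub (hF y) (integrable_const _)]
    simp
  rw [hevent]
  refine abs_integral_le_integral_abs.trans (integral_mono
    (integrable_finsetSum _ fun y _ => hF_sub y).abs
    (integrable_finsetSum _ fun y _ => (hF_sub y).abs) fun θ => ?_)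
  exact (Finset.abs_sum_le_sum_abs _ _).trans
    (Finset.sum_le_univ_sum_of_nonneg fun _ => abs_nonneg _)

lemma integral_le_add_measureReal [IsProbabilityMeasure ν] {g : E → ℝ} {A : Set E} {u : ℝ}
    (hA : MeasurableSet A) (hu : 0 ≤ u) (hg0 : ∀ θ, 0 ≤ g θ) (hg1 : ∀ θ, g θ ≤ 1)
    (hgA : ∀ᵐ θ ∂ν, θ ∉ A → g θ ≤ u) : ∫ θ, g θ ∂ν ≤ u + ν.real A := by
  have hindicator : Integrable (A.indicator fun _ => (1 : ℝ)) ν :=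
    (integrable_const 1).indicator hA
  calc ∫ θ, g θ ∂ν ≤ ∫ θ, (u + A.indicator (fun _ => 1) θ) ∂ν := by
        refine integral_mono_of_nonneg (Eventually.of_forall hg0)
          ((integrable_const u).add hindicator) ?_
        filter_upwards [hgA] with θ hθ
        by_cases hθA : θ ∈ A
        · simpa [hθA] using (hg1 θ).trans (le_add_of_nonneg_left hu)
        · simpa [hθA] using hθ hθA
    _ = u + ν.real A := by
        rw [integral_add (integrable_const u) hindicator, integral_indicator hA]
        simp

end Mixture

section Posterior

variable {k d p n : ℕ} {Q : Fin k → ℝ} {h : Fin k → EuclideanSpace ℝ (Fin d)}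
  {α : EuclideanSpace ℝ (Fin p) → EuclideanSpace ℝ (Fin d)}
  {prior μ : Measure (EuclideanSpace ℝ (Fin p))}

lemma aemeasurable_infoProj_comp (hQ : ∀ x, 0 < Q x) {Θ : Set (EuclideanSpace ℝ (Fin p))}
    (hΘ : MeasurableSet Θ) (hα : ContinuousOn α Θ) (hfeas : Set.MapsTo α Θ (feasibleMoments h))
    (hprior : prior Θᶜ = 0) : AEMeasurable (fun θ => infoProj Q h (α θ)) prior := by
  have := ((continuousOn_infoProj hQ).comp hα hfeas).aemeasurable (μ := prior) hΘ
  rwa [Measure.restrict_eq_self_of_ae_mem (mem_ae_iff.2 hprior)] at this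

lemma aemeasurable_iidLaw_infoProj (hP : AEMeasurable (fun θ => infoProj Q h (α θ)) μ)
    (x : Fin n → Fin k) : AEMeasurable (fun θ => iidLaw (infoProj Q h (α θ)) n x) μ := by
  have : Measurable fun P : Fin k → ℝ => iidLaw P n x := by unfold iidLaw; fun_prop
  exact this.comp_aemeasurable hP

lemma isProbabilityMeasure_posterior [IsProbabilityMeasure prior] (hQ : Q ∈ openSimplex k)
    (hP : AEMeasurable (fun θ => infoProj Q h (α θ)) prior) (x : Fin n → Fin k) :
    IsProbabilityMeasure (posterior Q h α prior x) := by
  have hmem (θ : EuclideanSpace ℝ (Fin p)) := infoProj_mem_openSimplex hQ h (α θ)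
  apply isProbabilityMeasure_inv_smul_withDensity
  · rw [Ne, lintegral_eq_zero_iff' (aemeasurable_iidLaw_infoProj hP x).ennreal_ofReal]
    intro hzero
    obtain ⟨θ, hθ⟩ := hzero.exists
    exact (iidLaw_pos (hmem θ).1 x).not_ge (ENNReal.ofReal_eq_zero.1 hθ)
  · refine ((lintegral_mono fun θ => ENNReal.ofReal_le_one.2
      (iidLaw_le_one (openSimplex_subset_stdSimplex (hmem θ)) x)).trans_lt ?_).ne
    simp

lemma posterior_absolutelyContinuous (x : Fin n → Fin k) : posterior Q h α prior x ≪ prior :=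
  Measure.smul_absolutelyContinuous.trans (withDensity_absolutelyContinuous _ _)

lemma integrable_iidLaw_infoProj [IsFiniteMeasure μ] (hQ : Q ∈ openSimplex k)
    (hP : AEMeasurable (fun θ => infoProj Q h (α θ)) μ) (y : Fin n → Fin k) :
    Integrable (fun θ => iidLaw (infoProj Q h (α θ)) n y) μ := by
  refine Integrable.of_bound (aemeasurable_iidLaw_infoProj hP y).aestronglyMeasurable 1
    (Eventually.of_forall fun θ => ?_)
  have hmem := openSimplex_subset_stdSimplex (infoProj_mem_openSimplex hQ h (α θ))
  rw [Real.norm_of_nonneg (iidLaw_nonneg hmem y)]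
  exact iidLaw_le_one hmem y

lemma norm_sub_le_one_of_mem_stdSimplex {P R : Fin k → ℝ} (hP : P ∈ stdSimplex ℝ (Fin k))
    (hR : R ∈ stdSimplex ℝ (Fin k)) : ‖P - R‖ ≤ 1 := by
  refine (pi_norm_le_iff_of_nonneg zero_le_one).2 fun x => ?_
  obtain ⟨hP0, hP1⟩ := mem_Icc_of_mem_stdSimplex hP x
  obtain ⟨hR0, hR1⟩ := mem_Icc_of_mem_stdSimplex hR x
  exact abs_le.2 ⟨by rw [Pi.sub_apply]; linarith, by rw [Pi.sub_apply]; linarith⟩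

lemma tvDist_predictive_le [IsProbabilityMeasure prior] (hQ : Q ∈ openSimplex k)
    (hP : AEMeasurable (fun θ => infoProj Q h (α θ)) prior) (x : Fin n → Fin k) (m : ℕ)
    {P₀ : Fin k → ℝ} (hP₀ : P₀ ∈ stdSimplex ℝ (Fin k)) :
    tvDist (predictive Q h α prior x m) (iidLaw P₀ m) ≤
      m * (k * ∫ θ, ‖infoProj Q h (α θ) - P₀‖ ∂posterior Q h α prior x) := by
  have := isProbabilityMeasure_posterior hQ hP x
  have hP' := hP.mono_ac (posterior_absolutelyContinuous (Q := Q) (h := h) (α := α) x)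
  have hmem (θ : EuclideanSpace ℝ (Fin p)) :=
    openSimplex_subset_stdSimplex (infoProj_mem_openSimplex hQ h (α θ))
  have hint : Integrable (fun θ => ‖infoProj Q h (α θ) - P₀‖) (posterior Q h α prior x) :=
    Integrable.of_bound (hP'.sub_const P₀).norm.aestronglyMeasurable 1
      (Eventually.of_forall fun θ => by
        rw [norm_norm]; exact norm_sub_le_one_of_mem_stdSimplex (hmem θ) hP₀)
  refine (tvDist_integral_le (fun y => integrable_iidLaw_infoProj hQ hP' y) (iidLaw P₀ m)).trans ?_
  rw [← integral_const_mul, ← integral_const_mul]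
  refine integral_mono_of_nonneg (Eventually.of_forall fun θ => by positivity)
    ((hint.const_mul _).const_mul _) (Eventually.of_forall fun θ => ?_)
  calc ∑ y, |iidLaw (infoProj Q h (α θ)) m y - iidLaw P₀ m y|
      ≤ m * ∑ z, |infoProj Q h (α θ) z - P₀ z| := sum_abs_iidLaw_sub_le (hmem θ) hP₀ m
    _ ≤ m * (k * ‖infoProj Q h (α θ) - P₀‖) := by
        gcongr
        simpa using Pi.sum_norm_apply_le_norm (infoProj Q h (α θ) - P₀)

end Posterior

section Deviation

variable {Ω : Type*} [MeasurableSpace Ω] {μ : Measure Ω} [IsProbabilityMeasure μ]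

lemma ae_eventually_sum_lt_of_hasSubgaussianMGF {Y : ℕ → Ω → ℝ} {c : NNReal} (hc : 0 < c)
    (hindep : iIndepFun Y μ) (hsub : ∀ i, HasSubgaussianMGF (Y i) c μ) :
    ∀ᵐ ω ∂μ, ∀ᶠ n : ℕ in atTop,
      ∑ i ∈ Finset.range n, Y i ω < √(4 * c * (n * Real.log n)) := by
  set s : ℕ → Set Ω := fun n => {ω | √(4 * c * (n * Real.log n)) ≤ ∑ i ∈ Finset.range n, Y i ω}
  have htail : ∀ᶠ n : ℕ in atTop, μ.real (s n) ≤ 1 / (n : ℝ) ^ 2 := by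
    filter_upwards [eventually_gt_atTop 0] with n hn
    have := Real.log_natCast_nonneg n
    refine (HasSubgaussianMGF.measure_sum_range_ge_le_of_iIndepFun hindep (fun i _ => hsub i)
      (Real.sqrt_nonneg _)).trans_eq ?_
    have hexp : -(4 * c * (n * Real.log n)) / (2 * n * c) = -(Real.log n + Real.log n) := by
      field_simp
      ring
    rw [Real.sq_sqrt (by positivity), hexp, Real.exp_neg, Real.exp_add,
      Real.exp_log (by positivity), ← sq, one_div]
  have hsum : Summable fun n => μ.real (s n) :=
    (Real.summable_one_div_nat_pow.2 one_lt_two).of_norm_bounded_eventually_nat <| by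
      simpa only [Real.norm_of_nonneg measureReal_nonneg] using htail
  have htsum : ∑' n, μ (s n) ≠ ⊤ := by
    simpa only [ofReal_measureReal (measure_ne_top μ _)] using hsum.tsum_ofReal_ne_top
  filter_upwards [ae_eventually_notMem htsum] with ω hω
  exact hω.mono fun n hn => not_le.1 hn

lemma ae_eventually_abs_sum_le_of_hasSubgaussianMGF {Y : ℕ → Ω → ℝ} {c : NNReal} (hc : 0 < c)
    (hindep : iIndepFun Y μ) (hsub : ∀ i, HasSubgaussianMGF (Y i) c μ) :
    ∀ᵐ ω ∂μ, ∀ᶠ n : ℕ in atTop,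
      |∑ i ∈ Finset.range n, Y i ω| ≤ √(4 * c * (n * Real.log n)) := by
  have hneg := ae_eventually_sum_lt_of_hasSubgaussianMGF hc
    (hindep.comp (fun _ => Neg.neg) fun _ => measurable_neg) fun i => (hsub i).neg
  filter_upwards [ae_eventually_sum_lt_of_hasSubgaussianMGF hc hindep hsub, hneg] with ω hω hω'
  filter_upwards [hω, hω'] with n hn hn'
  simp only [Function.comp_apply, Finset.sum_neg_distrib] at hn'
  exact abs_le'.2 ⟨hn.le, hn'.le⟩

lemma ae_eventually_abs_sum_indicator_sub_le {s : ℕ → Set Ω} (hs : ∀ i, MeasurableSet (s i))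
    (hindep : iIndepSet s μ) :
    ∀ᵐ ω ∂μ, ∀ᶠ n : ℕ in atTop,
      |∑ i ∈ Finset.range n, ((s i).indicator 1 ω - μ.real (s i))| ≤ √(n * Real.log n) := by
  have hsub (i : ℕ) :
      HasSubgaussianMGF (fun ω => (s i).indicator 1 ω - μ.real (s i)) (1 / 4) μ := by
    have := hasSubgaussianMGF_of_mem_Icc (μ := μ) (X := (s i).indicator (1 : Ω → ℝ)) (a := 0)
      (b := 1) (measurable_one.indicator (hs i)).aemeasurable
      (.of_forall fun ω => by by_cases hω : ω ∈ s i <;> simp [hω])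
    rw [integral_indicator_one (hs i)] at this
    convert this using 1
    norm_num
  have hindep' : iIndepFun (fun i ω => (s i).indicator (1 : Ω → ℝ) ω - μ.real (s i)) μ :=
    (hindep.iIndepFun_indicator (β := ℝ)).comp (fun i t => t - μ.real (s i)) fun i => by fun_prop
  simpa using ae_eventually_abs_sum_le_of_hasSubgaussianMGF (by norm_num) hindep' hsub

variable {k : ℕ} {X : ℕ → Ω → Fin k} {P : Fin k → ℝ}

lemma ae_eventually_norm_empirical_sub_le (hX : ∀ i, Measurable (X i)) (hindep : iIndepFun X μ)
    (hlaw : ∀ i x, μ.real (X i ⁻¹' {x}) = P x) :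
    ∀ᵐ ω ∂μ, ∀ᶠ n : ℕ in atTop,
      ‖empirical (fun i : Fin n => X i ω) - P‖ ≤ √(Real.log n / n) := by
  have hdev (x : Fin k) := ae_eventually_abs_sum_indicator_sub_le (μ := μ)
    (fun i => hX i (measurableSet_singleton x)) <|
    (iIndepSet_iff_meas_biInter fun i => hX i (measurableSet_singleton x)).2 fun s =>
      hindep.measure_inter_preimage_eq_mul s fun _ _ => measurableSet_singleton x
  filter_upwards [ae_all_iff.2 hdev] with ω hω
  filter_upwards [eventually_all.2 hω, eventually_gt_atTop 0] with n hn hn0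
  refine (pi_norm_le_iff_of_nonneg (Real.sqrt_nonneg _)).2 fun x => ?_
  have hsum : ∑ i ∈ Finset.range n, ((X i ⁻¹' {x}).indicator 1 ω - μ.real (X i ⁻¹' {x})) =
      n * (empirical (fun i : Fin n => X i ω) - P) x := by
    simp only [hlaw]
    rw [Finset.sum_sub_distrib, Finset.sum_const, Finset.card_range, nsmul_eq_mul, Pi.sub_apply,
      mul_sub, empirical, mul_div_cancel₀ _ (by positivity : (n : ℝ) ≠ 0),
      ← Fin.sum_univ_eq_sum_range (fun i => (X i ⁻¹' {x}).indicator (1 : Ω → ℝ) ω)]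
    simp [Set.indicator, Finset.sum_boole]
  have hsqrt : √(n * Real.log n) = n * √(Real.log n / n) := by
    rw [← Real.sqrt_sq n.cast_nonneg, ← Real.sqrt_mul (sq_nonneg _), Real.sqrt_sq n.cast_nonneg]
    congr 1
    field_simp
  have hx := hn x
  rw [hsum, hsqrt, abs_mul, Nat.abs_cast] at hx
  exact le_of_mul_le_mul_left hx (by positivity)

end Deviation

section Rate

variable {lam : ℝ} {n : ℕ}

lemma rate_nonneg (n : ℕ) (lam : ℝ) : 0 ≤ rate n lam := Real.sqrt_nonneg _

lemma sqrt_mul_rate (hlam : 0 < lam) (n : ℕ) : √lam * rate n lam = √(Real.log n / n) := by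
  rw [rate, ← Real.sqrt_mul hlam.le]
  congr 1
  field_simp

lemma tendsto_rate (lam : ℝ) : Tendsto (fun n : ℕ => rate n lam) atTop (𝓝 0) := by
  have hlog : Tendsto (fun t : ℝ => Real.log t / (t * lam)) atTop (𝓝 0) := by
    simpa [div_div] using
      (Real.tendsto_pow_log_div_mul_add_atTop 1 0 1 one_ne_zero).div_const lam
  simpa [rate] using (hlog.comp tendsto_natCast_atTop_atTop).sqrt

lemma eventually_forall_norm_sub_le_rate {E : Type*} [SeminormedAddCommGroup E] {θ₀ : E}
    {q : E → Prop} (hq : ∀ᶠ θ in 𝓝 θ₀, q θ) (C lam : ℝ) :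
    ∀ᶠ n : ℕ in atTop, ∀ θ, ‖θ - θ₀‖ ≤ C * rate n lam → q θ := by
  obtain ⟨ε, hε, hball⟩ := Metric.eventually_nhds_iff.1 hq
  have hlim : Tendsto (fun n : ℕ => C * rate n lam) atTop (𝓝 0) := by
    simpa using (tendsto_rate lam).const_mul C
  filter_upwards [hlim.eventually_lt_const hε] with n hn θ hθ
  exact hball (by rw [dist_eq_norm]; exact hθ.trans_lt hn)

lemma exp_neg_mul_sq_rate (hlam : 0 < lam) (hn : n ≠ 0) (e : ℝ) :
    Real.exp (-(n * (e * rate n lam ^ 2))) = (n : ℝ) ^ (-(e / lam)) := by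
  have := Real.log_natCast_nonneg n
  rw [rate, Real.sq_sqrt (by positivity), Real.rpow_def_of_pos (by positivity)]
  congr 1
  field_simp

lemma eventually_rpow_neg_half_le_rate (hlam : 0 < lam) :
    ∀ᶠ n : ℕ in atTop, (n : ℝ) ^ (-(1 / 2) : ℝ) ≤ rate n lam := by
  have hlog := Real.tendsto_log_atTop.comp tendsto_natCast_atTop_atTop
  filter_upwards [hlog.eventually_ge_atTop lam, eventually_gt_atTop 0] with n hn hn0
  refine Real.le_sqrt_of_sq_le ?_
  rw [← Real.rpow_mul_natCast n.cast_nonneg, show (-(1 / 2) * (2 : ℕ) : ℝ) = -1 by norm_num,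
    Real.rpow_neg_one, le_div_iff₀ (by positivity), inv_mul_cancel_left₀ (by positivity)]
  exact hn

end Rate

section Prior

/-- A measure charges the small balls around `x` at least like their volume in dimension `q`. This
is all that posterior concentration requires of the prior. -/
def IsThickAt {E : Type*} [PseudoMetricSpace E] [MeasurableSpace E] (μ : Measure E) (x : E)
    (q : ℕ) : Prop :=
  ∃ b > 0, ∀ᶠ r in 𝓝[>] (0 : ℝ), ENNReal.ofReal (b * r ^ q) ≤ μ (Metric.ball x r)

lemma isThickAt_of_restrict_eq_withDensity {E : Type*} [NormedAddCommGroup E] [NormedSpace ℝ E]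
    [FiniteDimensional ℝ E] [MeasurableSpace E] [BorelSpace E] {μ ν : Measure E}
    [ν.IsAddHaarMeasure] {x : E} {U : Set E} (hU : U ∈ 𝓝 x) {f : E → ℝ} (hf : ContinuousAt f x)
    (hfx : 0 < f x)
    (hdens : μ.restrict U = (ν.restrict U).withDensity fun θ => ENNReal.ofReal (f θ)) :
    IsThickAt μ x (Module.finrank ℝ E) := by
  obtain ⟨ε, hε, hball⟩ := Metric.mem_nhds_iff.1
    (inter_mem (hf.eventually_const_lt (half_lt_self hfx)) hU)
  have hpos : 0 < ν.real (Metric.ball 0 1) :=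
    ENNReal.toReal_pos (Metric.measure_ball_pos _ _ one_pos).ne' measure_ball_lt_top.ne
  refine ⟨f x / 2 * ν.real (Metric.ball 0 1), by positivity, ?_⟩
  filter_upwards [Ioo_mem_nhdsGT hε] with r hr
  have hsub := (Metric.ball_subset_ball hr.2.le).trans hball
  have hrestrict (μ : Measure E) : μ.restrict U (Metric.ball x r) = μ (Metric.ball x r) :=
    Measure.restrict_eq_self μ (hsub.trans Set.inter_subset_right)
  calc ENNReal.ofReal (f x / 2 * ν.real (Metric.ball 0 1) * r ^ Module.finrank ℝ E)
      = ENNReal.ofReal (f x / 2) * ν (Metric.ball x r) := by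
        rw [Measure.addHaar_ball_of_pos ν x hr.1, mul_assoc, ENNReal.ofReal_mul (by positivity),
          ENNReal.ofReal_mul hpos.le, ofReal_measureReal measure_ball_lt_top.ne,
          mul_comm (ν _)]
    _ = ∫⁻ _ in Metric.ball x r, ENNReal.ofReal (f x / 2) ∂ν.restrict U := by
        rw [setLIntegral_const, hrestrict]
    _ ≤ ∫⁻ θ in Metric.ball x r, ENNReal.ofReal (f θ) ∂ν.restrict U :=
        setLIntegral_mono' measurableSet_ball fun θ hθ => ENNReal.ofReal_le_ofReal (hsub hθ).1.le
    _ = μ (Metric.ball x r) := by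
        rw [← withDensity_apply _ measurableSet_ball, ← hdens, hrestrict]

end Prior

section Identification

variable {E F : Type*} [NormedAddCommGroup E] [NormedAddCommGroup F]

lemma tendsto_nhdsWithin_of_isBigO_sub {α : E → F} {θ₀ : E}
    (hα : (α · - α θ₀) =O[𝓝 θ₀] (· - θ₀)) {s : Set F} (hs : ∀ᶠ θ in 𝓝 θ₀, α θ ∈ s) :
    Tendsto α (𝓝 θ₀) (𝓝[s] (α θ₀)) :=
  tendsto_nhdsWithin_iff.2 ⟨tendsto_sub_nhds_zero_iff.1 <| hα.trans_tendsto <|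
    tendsto_sub_nhds_zero_iff.2 tendsto_id, hs⟩

/-- The values of `α` on `Θ` identify `θ₀` at a linear rate: `‖α θ - α θ₀‖` is at least proportional
to `‖θ - θ₀‖`, truncated at `1` because nothing more can be asked away from `θ₀`. -/
def LinearlyIdentified (α : E → F) (Θ : Set E) (θ₀ : E) : Prop :=
  ∃ κ > 0, ∀ θ ∈ Θ, κ * min ‖θ - θ₀‖ 1 ≤ ‖α θ - α θ₀‖

lemma linearlyIdentified_of_isTheta {α : E → F} {Θ : Set E} {θ₀ : E}
    (hα : (α · - α θ₀) =Θ[𝓝 θ₀] (· - θ₀))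
    (hident : ∀ ε > 0, ∃ η > 0, ∀ θ ∈ Θ, ε ≤ ‖θ - θ₀‖ → η ≤ ‖α θ - α θ₀‖) :
    LinearlyIdentified α Θ θ₀ := by
  obtain ⟨K, hK, hbound⟩ := hα.2.exists_pos
  obtain ⟨ε, hε, hnear⟩ := Metric.eventually_nhds_iff.1 hbound.bound
  obtain ⟨η, hη, hfar⟩ := hident ε hε
  refine ⟨min K⁻¹ η, by positivity, fun θ hθ => ?_⟩
  rcases lt_or_ge ‖θ - θ₀‖ ε with hlt | hge
  · calc min K⁻¹ η * min ‖θ - θ₀‖ 1 ≤ K⁻¹ * ‖θ - θ₀‖ := by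
          gcongr <;> exact min_le_left _ _
      _ ≤ ‖α θ - α θ₀‖ := (inv_mul_le_iff₀ hK).2 (hnear (by rwa [dist_eq_norm]))
  · calc min K⁻¹ η * min ‖θ - θ₀‖ 1 ≤ η * 1 := by
          gcongr <;> exact min_le_right _ _
      _ ≤ ‖α θ - α θ₀‖ := by simpa using hfar θ hθ hge

end Identification

section Concentration

variable {k d p : ℕ} {Q : Fin k → ℝ} {h : Fin k → EuclideanSpace ℝ (Fin d)}
  {Θ : Set (EuclideanSpace ℝ (Fin p))} {α : EuclideanSpace ℝ (Fin p) → EuclideanSpace ℝ (Fin d)}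
  {θ₀ : EuclideanSpace ℝ (Fin p)} {lam M : ℝ}

/-- The samples of size `n` whose empirical moment is `r`-close to `a`. They carry the whole
probabilistic content of posterior concentration, which is deterministic on them. -/
def typicalSamples (h : Fin k → EuclideanSpace ℝ (Fin d)) (a : EuclideanSpace ℝ (Fin d)) (r : ℝ)
    (n : ℕ) : Set (Fin n → Fin k) :=
  {x | ‖empiricalMoment h x - a‖ ≤ r}

lemma mem_typicalSamples_of_empirical_mem_feasible {a : EuclideanSpace ℝ (Fin d)} {r : ℝ}
    (hr : 0 ≤ r) {n : ℕ} {x : Fin n → Fin k} (hx : empirical x ∈ feasible h a) :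
    x ∈ typicalSamples h a r n := by
  simpa [typicalSamples, empiricalMoment, hx.2] using hr

lemma exists_ae_eventually_mem_typicalSamples {Ω : Type*} [MeasurableSpace Ω] {μ : Measure Ω}
    [IsProbabilityMeasure μ] {X : ℕ → Ω → Fin k} (hX : ∀ i, Measurable (X i))
    (hindep : iIndepFun X μ) {P : Fin k → ℝ} (hlaw : ∀ i x, μ.real (X i ⁻¹' {x}) = P x)
    (h : Fin k → EuclideanSpace ℝ (Fin d)) (hlam : 0 < lam) :
    ∃ M ≥ 0, ∀ᵐ ω ∂μ, ∀ᶠ n : ℕ in atTop,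
      (fun i : Fin n => X i ω) ∈ typicalSamples h (∑ x, P x • h x) (M * rate n lam) n := by
  refine ⟨(∑ x, ‖h x‖) * √lam, by positivity, ?_⟩
  filter_upwards [ae_eventually_norm_empirical_sub_le hX hindep hlaw] with ω hω
  filter_upwards [hω] with n hn
  rw [← sqrt_mul_rate hlam] at hn
  calc _ ≤ (∑ x, ‖h x‖) * ‖empirical (fun i : Fin n => X i ω) - P‖ := norm_sum_smul_sub_le h _ P
    _ ≤ (∑ x, ‖h x‖) * √lam * rate n lam := by rw [mul_assoc]; gcongr

lemma eventually_empiricalMoment_mem {a : EuclideanSpace ℝ (Fin d)} (ha : a ∈ feasibleMoments h)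
    {t : Set (EuclideanSpace ℝ (Fin d))} (ht : t ∈ 𝓝[feasibleMoments h] a) (M lam : ℝ) :
    ∀ᶠ n : ℕ in atTop, ∀ x ∈ typicalSamples h a (M * rate n lam) n, empiricalMoment h x ∈ t := by
  have ht' : ∀ᶠ b in 𝓝 a, b ∈ affineSpan ℝ (Set.range h) → b ∈ t := eventually_nhdsWithin_iff.1 <|
    nhdsWithin_le_of_mem (feasibleMoments_mem_nhdsWithin_affineSpan ha) ht
  filter_upwards [eventually_forall_norm_sub_le_rate ht' M lam, eventually_ne_atTop 0]
    with n hn hn0 x hx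
  exact hn _ hx (sum_smul_mem_affineSpan h (sum_empirical hn0 x))

lemma exists_iidLaw_infoProj_le (hQ : ∀ x, 0 < Q x)
    (hfeas : Set.MapsTo α Θ (feasibleMoments h)) (hθ₀ : θ₀ ∈ Θ)
    (hid : LinearlyIdentified α Θ θ₀) (hlam : 0 < lam) (hM : 0 ≤ M) {e : ℝ} (he : 0 < e) :
    ∃ C > 0, ∀ᶠ n : ℕ in atTop, ∀ x ∈ typicalSamples h (α θ₀) (M * rate n lam) n, ∀ θ ∈ Θ,
      C * rate n lam < ‖θ - θ₀‖ → iidLaw (infoProj Q h (α θ)) n x ≤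
        iidLaw (infoProj Q h (empiricalMoment h x)) n x * (n : ℝ) ^ (-e) := by
  obtain ⟨κ, hκ, hsep⟩ := hid
  obtain ⟨γ, hγ, hkl⟩ := exists_sq_norm_sub_le_kl_infoProj hQ h
  set t := √(e * lam / γ)
  have ht : 0 < t := by positivity
  have ht2 : γ * t ^ 2 = e * lam := by
    rw [Real.sq_sqrt (by positivity)]
    field_simp
  have hC : κ * ((M + t) / κ) = M + t := by field_simp
  refine ⟨(M + t) / κ, by positivity, ?_⟩
  have hlim : Tendsto (fun n : ℕ => (M + t) / κ * rate n lam) atTop (𝓝 0) := by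
    simpa using (tendsto_rate lam).const_mul ((M + t) / κ)
  filter_upwards [eventually_empiricalMoment_mem (hfeas hθ₀) self_mem_nhdsWithin M lam,
    hlim.eventually_le_const one_pos, eventually_ne_atTop 0] with n hmem hsmall hn x hx θ hθ hfar
  have hr := rate_nonneg n lam
  have hsep_x : t * rate n lam ≤ ‖empiricalMoment h x - α θ‖ := by
    have hαθ : κ * ((M + t) / κ * rate n lam) ≤ ‖α θ - α θ₀‖ :=
      (mul_le_mul_of_nonneg_left (le_min hfar.le hsmall) hκ.le).trans (hsep θ hθ)
    rw [← mul_assoc, hC] at hαθ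
    have hx' : ‖empiricalMoment h x - α θ₀‖ ≤ M * rate n lam := hx
    have htri := norm_sub_le_norm_sub_add_norm_sub (α θ) (empiricalMoment h x) (α θ₀)
    rw [norm_sub_rev (α θ) (empiricalMoment h x)] at htri
    linarith
  rw [iidLaw_infoProj_eq_mul_exp hQ (hfeas hθ) hn (hmem x hx)]
  refine mul_le_mul_of_nonneg_left ?_ (iidLaw_pos (infoProj_mem_feasible hQ (hmem x hx)).1.1 x).le
  calc _ ≤ Real.exp (-(n * (e * lam * rate n lam ^ 2))) := by
        gcongr
        calc e * lam * rate n lam ^ 2 = γ * (t * rate n lam) ^ 2 := by rw [← ht2]; ring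
          _ ≤ γ * ‖empiricalMoment h x - α θ‖ ^ 2 := by gcongr
          _ ≤ _ := hkl _ (hmem x hx) _ (hfeas hθ)
    _ = (n : ℝ) ^ (-e) := by
      rw [exp_neg_mul_sq_rate hlam hn, mul_div_cancel_right₀ _ hlam.ne']

lemma exists_le_iidLaw_infoProj (hQ : ∀ x, 0 < Q x)
    (hfeas : ∀ᶠ θ in 𝓝 θ₀, α θ ∈ feasibleMoments h) (hα : (α · - α θ₀) =O[𝓝 θ₀] (· - θ₀))
    (hlam : 0 < lam) (M : ℝ) :
    ∃ e ≥ (0 : ℝ), ∀ᶠ n : ℕ in atTop, ∀ x ∈ typicalSamples h (α θ₀) (M * rate n lam) n,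
      ∀ θ ∈ Metric.ball θ₀ (rate n lam),
        iidLaw (infoProj Q h (empiricalMoment h x)) n x * (n : ℝ) ^ (-e) ≤
          iidLaw (infoProj Q h (α θ)) n x := by
  have ha := hfeas.self_of_nhds
  obtain ⟨Γ, hΓ, t, ht, hkl⟩ := exists_kl_infoProj_le hQ ha
  obtain ⟨L, hL, hbound⟩ := hα.exists_nonneg
  have hαt := tendsto_nhdsWithin_of_isBigO_sub hα hfeas
  refine ⟨Γ * (M + L) ^ 2 / lam, by positivity, ?_⟩
  filter_upwards [eventually_empiricalMoment_mem ha (inter_mem ht self_mem_nhdsWithin) M lam,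
    eventually_forall_norm_sub_le_rate ((hfeas.and (hαt ht)).and hbound.bound) 1 lam,
    eventually_ne_atTop 0] with n hmem hball hn x hx θ hθ
  rw [Metric.mem_ball, dist_eq_norm] at hθ
  obtain ⟨⟨hθfeas, hθt⟩, hθL⟩ := hball θ (by rw [one_mul]; exact hθ.le)
  have hclose : ‖empiricalMoment h x - α θ‖ ≤ (M + L) * rate n lam := by
    have hx' : ‖empiricalMoment h x - α θ₀‖ ≤ M * rate n lam := hx
    have hθ' : ‖α θ - α θ₀‖ ≤ L * rate n lam := hθL.trans (by gcongr)
    have htri := norm_sub_le_norm_sub_add_norm_sub (empiricalMoment h x) (α θ₀) (α θ)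
    rw [norm_sub_rev (α θ₀)] at htri
    linarith
  rw [iidLaw_infoProj_eq_mul_exp hQ hθfeas hn (hmem x hx).2, ← exp_neg_mul_sq_rate hlam hn]
  refine mul_le_mul_of_nonneg_left ?_ (iidLaw_pos (infoProj_mem_feasible hQ (hmem x hx).2).1.1 x).le
  gcongr
  calc _ ≤ Γ * ‖empiricalMoment h x - α θ‖ ^ 2 := hkl _ (hmem x hx).1 _ hθt
    _ ≤ Γ * ((M + L) * rate n lam) ^ 2 := by gcongr
    _ = _ := by ring

variable {prior : Measure (EuclideanSpace ℝ (Fin p))} [IsProbabilityMeasure prior]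

lemma posterior_apply_le {n : ℕ} {x : Fin n → Fin k} {A B : Set (EuclideanSpace ℝ (Fin p))}
    (hA : MeasurableSet A) (hB : MeasurableSet B) {u l v : ℝ} (hl : 0 < l) (hv : 0 < v)
    (hu : ∀ᵐ θ ∂prior, θ ∈ A → iidLaw (infoProj Q h (α θ)) n x ≤ u)
    (hlB : ∀ θ ∈ B, l ≤ iidLaw (infoProj Q h (α θ)) n x) (hvB : ENNReal.ofReal v ≤ prior B) :
    posterior Q h α prior x A ≤ ENNReal.ofReal (u / (l * v)) := by
  calc posterior Q h α prior x A ≤ ENNReal.ofReal u / (ENNReal.ofReal l * prior B) :=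
        inv_smul_withDensity_apply_le hA hB
          (hu.mono fun θ hθ hθA => ENNReal.ofReal_le_ofReal (hθ hθA))
          fun θ hθ => ENNReal.ofReal_le_ofReal (hlB θ hθ)
    _ ≤ ENNReal.ofReal u / (ENNReal.ofReal l * ENNReal.ofReal v) := by gcongr
    _ = ENNReal.ofReal (u / (l * v)) := by
        rw [ENNReal.ofReal_div_of_pos (by positivity), ENNReal.ofReal_mul hl.le]

theorem exists_posterior_le (hQ : Q ∈ openSimplex k)
    (hfeas : Set.MapsTo α Θ (feasibleMoments h)) (hθ₀ : Θ ∈ 𝓝 θ₀)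
    (hα : (α · - α θ₀) =O[𝓝 θ₀] (· - θ₀)) (hid : LinearlyIdentified α Θ θ₀)
    (hprior : ∀ᵐ θ ∂prior, θ ∈ Θ) {q : ℕ} (hthick : IsThickAt prior θ₀ q)
    (hlam : 0 < lam) (hM : 0 ≤ M) {c : ℝ} (hc : 0 < c) :
    ∃ C > 0, ∃ K > 0, ∀ᶠ n : ℕ in atTop, ∀ x ∈ typicalSamples h (α θ₀) (M * rate n lam) n,
      posterior Q h α prior x {θ | C * rate n lam < ‖θ - θ₀‖} ≤
        ENNReal.ofReal (K * (n : ℝ) ^ (-c)) := by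
  obtain ⟨e, he, hnear⟩ :=
    exists_le_iidLaw_infoProj hQ.1 (mem_of_superset hθ₀ hfeas) hα hlam M
  obtain ⟨C, hC, hfar⟩ := exists_iidLaw_infoProj_le hQ.1 hfeas (mem_of_mem_nhds hθ₀) hid hlam hM
    (by positivity : 0 < e + q / 2 + c)
  obtain ⟨b, hb, hmass⟩ := hthick
  refine ⟨C, hC, b⁻¹, by positivity, ?_⟩
  have hrate : ∀ᶠ n : ℕ in atTop, 0 < rate n lam := by
    filter_upwards [eventually_rpow_neg_half_le_rate hlam, eventually_gt_atTop 0] with n hn hn0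
    exact (by positivity : 0 < (n : ℝ) ^ (-(1 / 2) : ℝ)).trans_le hn
  have hmass' := (tendsto_nhdsWithin_iff.2 ⟨tendsto_rate lam, hrate⟩).eventually hmass
  filter_upwards [hnear, hfar, hmass', eventually_rpow_neg_half_le_rate hlam,
    eventually_gt_atTop 0] with n hnear hfar hmass hhalf hn x hx
  have hL : 0 < iidLaw (infoProj Q h (empiricalMoment h x)) n x :=
    iidLaw_pos (infoProj_mem_openSimplex hQ h _).1 x
  have hball : b * (n : ℝ) ^ (-(q / 2) : ℝ) ≤ b * rate n lam ^ q := by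
    rw [show (-(q / 2) : ℝ) = -(1 / 2) * q by ring, Real.rpow_mul_natCast n.cast_nonneg]
    gcongr
  have hmeas : MeasurableSet {θ : EuclideanSpace ℝ (Fin p) | C * rate n lam < ‖θ - θ₀‖} :=
    measurableSet_lt (by fun_prop) (by fun_prop)
  refine (posterior_apply_le hmeas measurableSet_ball (by positivity) (by positivity)
    (hprior.mono fun θ hθ => hfar x hx θ hθ) (hnear x hx)
    ((ENNReal.ofReal_le_ofReal hball).trans hmass)).trans_eq ?_
  congr 1
  have hn' : (0 : ℝ) < n := by positivity
  rw [show -(e + q / 2 + c) = -e + -(q / 2) + -c by ring, Real.rpow_add hn', Real.rpow_add hn']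
  field_simp

lemma tvDist_predictive_le_of_posterior_le (hQ : Q ∈ openSimplex k)
    (hP : AEMeasurable (fun θ => infoProj Q h (α θ)) prior) {n : ℕ} {x : Fin n → Fin k}
    {s u ε : ℝ} (hu : 0 ≤ u) (hε : 0 ≤ ε)
    (hnear : ∀ θ, ‖θ - θ₀‖ ≤ s → ‖infoProj Q h (α θ) - infoProj Q h (α θ₀)‖ ≤ u)
    (hpost : posterior Q h α prior x {θ | s < ‖θ - θ₀‖} ≤ ENNReal.ofReal ε) (m : ℕ) :
    tvDist (predictive Q h α prior x m) (iidLaw (infoProj Q h (α θ₀)) m) ≤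
      m * (k * (u + ε)) := by
  have hsimplex (a) := openSimplex_subset_stdSimplex (infoProj_mem_openSimplex hQ h a)
  have := isProbabilityMeasure_posterior hQ hP x
  have hmass : (posterior Q h α prior x).real {θ | s < ‖θ - θ₀‖} ≤ ε :=
    ENNReal.toReal_le_of_le_ofReal hε hpost
  have hint := integral_le_add_measureReal (ν := posterior Q h α prior x)
    (g := fun θ => ‖infoProj Q h (α θ) - infoProj Q h (α θ₀)‖)
    (measurableSet_lt (by fun_prop) (by fun_prop) : MeasurableSet {θ | s < ‖θ - θ₀‖}) hu
    (fun _ => norm_nonneg _) (fun θ => norm_sub_le_one_of_mem_stdSimplex (hsimplex _) (hsimplex _))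
    (.of_forall fun θ hθ => hnear θ (not_lt.1 hθ))
  refine (tvDist_predictive_le hQ hP x m (hsimplex (α θ₀))).trans ?_
  gcongr
  exact hint.trans (by gcongr)

theorem exists_tvDist_predictive_le (hQ : Q ∈ openSimplex k)
    (hfeas : Set.MapsTo α Θ (feasibleMoments h)) (hθ₀ : Θ ∈ 𝓝 θ₀)
    (hα : (α · - α θ₀) =O[𝓝 θ₀] (· - θ₀)) (hid : LinearlyIdentified α Θ θ₀)
    (hprior : ∀ᵐ θ ∂prior, θ ∈ Θ) (hP : AEMeasurable (fun θ => infoProj Q h (α θ)) prior)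
    {q : ℕ} (hthick : IsThickAt prior θ₀ q) (hlam : 0 < lam) (hM : 0 ≤ M) :
    ∃ K > 0, ∀ᶠ n : ℕ in atTop, ∀ x ∈ typicalSamples h (α θ₀) (M * rate n lam) n, ∀ m : ℕ,
      tvDist (predictive Q h α prior x m) (iidLaw (infoProj Q h (α θ₀)) m) ≤
        K * (m * rate n lam) := by
  obtain ⟨C, hC, K, hK, hpost⟩ :=
    exists_posterior_le hQ hfeas hθ₀ hα hid hprior hthick hlam hM one_half_pos
  have hfeas' : ∀ᶠ θ in 𝓝 θ₀, α θ ∈ feasibleMoments h := mem_of_superset hθ₀ hfeas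
  have hlip : (fun θ => infoProj Q h (α θ) - infoProj Q h (α θ₀)) =O[𝓝 θ₀] (· - θ₀) :=
    ((isBigO_infoProj_sub hQ.1 hfeas'.self_of_nhds).comp_tendsto
      (tendsto_nhdsWithin_of_isBigO_sub hα hfeas')).trans hα
  obtain ⟨L, hL, hbound⟩ := hlip.exists_nonneg
  refine ⟨(k + 1) * (L * C + K), by positivity, ?_⟩
  filter_upwards [hpost, eventually_forall_norm_sub_le_rate hbound.bound C lam,
    eventually_rpow_neg_half_le_rate hlam] with n hpost hlip hhalf x hx m
  have hr := rate_nonneg n lam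
  calc _ ≤ m * (k * (L * (C * rate n lam) + K * (n : ℝ) ^ (-(1 / 2) : ℝ))) :=
        tvDist_predictive_le_of_posterior_le hQ hP (by positivity) (by positivity)
          (fun θ hθ => (hlip θ hθ).trans (by gcongr)) (hpost x hx) m
    _ ≤ m * ((k + 1) * (L * (C * rate n lam) + K * rate n lam)) := by
        gcongr
        linarith
    _ = _ := by ring

end Concentration

end BETEL

theorem mainTheorem7 {k d p : ℕ}
    -- the reference law, the feature map and the moment constraint
    (Q : Fin k → ℝ) (hQ : Q ∈ BETEL.openSimplex k)
    (h : Fin k → EuclideanSpace ℝ (Fin d))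
    (hT : BETEL.tangentSpace h ≠ ⊥)
    (Θ : Set (EuclideanSpace ℝ (Fin p))) (hΘ : MeasurableSet Θ)
    (α : EuclideanSpace ℝ (Fin p) → EuclideanSpace ℝ (Fin d))
    (hα : ContinuousOn α Θ)
    (hfeas : ∀ θ ∈ Θ, (BETEL.feasible h (α θ)).Nonempty)
    -- smoothness, interiority and identification at the true parameter
    (θ₀ : EuclideanSpace ℝ (Fin p)) (hθ₀ : θ₀ ∈ interior Θ)
    (α' : EuclideanSpace ℝ (Fin p) →L[ℝ] EuclideanSpace ℝ (Fin d))
    (hderiv : HasFDerivAt α α' θ₀) (hinj : Function.Injective α')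
    (hident : ∀ ε > 0, ∃ η > 0, ∀ θ ∈ Θ, ε ≤ ‖θ - θ₀‖ → η ≤ ‖α θ - α θ₀‖)
    -- the prior, with a positive continuous density near the true parameter
    (prior : Measure (EuclideanSpace ℝ (Fin p))) [IsProbabilityMeasure prior]
    (hprior : prior Θᶜ = 0)
    (U : Set (EuclideanSpace ℝ (Fin p))) (hU : IsOpen U) (hθ₀U : θ₀ ∈ U)
    (f : EuclideanSpace ℝ (Fin p) → ℝ) (hfcont : ContinuousOn f U) (hfpos : ∀ θ ∈ U, 0 < f θ)
    (hdens : prior.restrict U =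
      (volume.restrict U).withDensity fun θ => ENNReal.ofReal (f θ))
    -- independent observations whose law satisfies the constraint at the true parameter
    {Ω : Type*} [MeasurableSpace Ω] (Pr : Measure Ω) [IsProbabilityMeasure Pr]
    (X : ℕ → Ω → Fin k) (hX : ∀ i, Measurable (X i)) (hindep : iIndepFun X Pr)
    (P₀ : Fin k → ℝ) (hlaw : ∀ i x, Pr.real (X i ⁻¹' {x}) = P₀ x)
    (hP₀ : ∑ x, P₀ x • h x = α θ₀) :
    -- the posterior is well defined
    (∀ (n : ℕ) (x : Fin n → Fin k), IsProbabilityMeasure (BETEL.posterior Q h α prior x)) ∧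
    -- posterior concentration
    (∀ c : ℝ, 0 < c → ∃ C > 0, ∃ K > 0,
      (∀ᵐ ω ∂Pr, ∀ᶠ n : ℕ in atTop,
        BETEL.posterior Q h α prior (fun i : Fin n => X i ω)
          {θ | C * BETEL.rate n (BETEL.curvature h (BETEL.infoProj Q h (α θ₀))) < ‖θ - θ₀‖}
          ≤ ENNReal.ofReal (K * (n : ℝ) ^ (-c))) ∧
      (∀ᶠ n : ℕ in atTop, ∀ x : Fin n → Fin k,
        BETEL.empirical x ∈ BETEL.feasible h (α θ₀) →
        BETEL.posterior Q h α prior x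
          {θ | C * BETEL.rate n (BETEL.curvature h (BETEL.infoProj Q h (α θ₀))) < ‖θ - θ₀‖}
          ≤ ENNReal.ofReal (K * (n : ℝ) ^ (-c)))) ∧
    -- predictive law, uniformly in the number `m` of future observations
    (∃ K > 0,
      (∀ᵐ ω ∂Pr, ∀ᶠ n : ℕ in atTop, ∀ m : ℕ,
        BETEL.tvDist (BETEL.predictive Q h α prior (fun i : Fin n => X i ω) m)
          (BETEL.iidLaw (BETEL.infoProj Q h (α θ₀)) m)
          ≤ K * (m * BETEL.rate n (BETEL.curvature h (BETEL.infoProj Q h (α θ₀))))) ∧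
      (∀ᶠ n : ℕ in atTop, ∀ x : Fin n → Fin k,
        BETEL.empirical x ∈ BETEL.feasible h (α θ₀) → ∀ m : ℕ,
        BETEL.tvDist (BETEL.predictive Q h α prior x m)
          (BETEL.iidLaw (BETEL.infoProj Q h (α θ₀)) m)
          ≤ K * (m * BETEL.rate n (BETEL.curvature h (BETEL.infoProj Q h (α θ₀)))))) := by
  have hΘ₀ : Θ ∈ 𝓝 θ₀ := mem_interior_iff_mem_nhds.1 hθ₀
  have hfeas' : Set.MapsTo α Θ (BETEL.feasibleMoments h) := hfeas
  have hTheta : (α · - α θ₀) =Θ[𝓝 θ₀] (· - θ₀) := hderiv.isTheta_sub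
    (LinearMap.isClosedEmbedding_of_injective (LinearMap.ker_eq_bot.2 hinj)).isInducing
  have hid := BETEL.linearlyIdentified_of_isTheta hTheta hident
  have hthick := BETEL.isThickAt_of_restrict_eq_withDensity (hU.mem_nhds hθ₀U)
    (hfcont.continuousAt (hU.mem_nhds hθ₀U)) (hfpos θ₀ hθ₀U) hdens
  have hP := BETEL.aemeasurable_infoProj_comp hQ.1 hΘ hα hfeas' hprior
  have hlam : 0 < BETEL.curvature h (BETEL.infoProj Q h (α θ₀)) :=
    one_pos.trans_le (BETEL.one_le_curvature hT (BETEL.infoProj_mem_openSimplex hQ h _))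
  obtain ⟨M, hM, htypical⟩ :=
    BETEL.exists_ae_eventually_mem_typicalSamples hX hindep hlaw h hlam
  rw [hP₀] at htypical
  have hexact (n : ℕ) (x : Fin n → Fin k) (hx : BETEL.empirical x ∈ BETEL.feasible h (α θ₀)) :=
    BETEL.mem_typicalSamples_of_empirical_mem_feasible
      (mul_nonneg hM (BETEL.rate_nonneg n (BETEL.curvature h (BETEL.infoProj Q h (α θ₀))))) hx
  refine ⟨fun n x => BETEL.isProbabilityMeasure_posterior hQ hP x, fun c hc => ?_, ?_⟩
  · obtain ⟨C, hC, K, hK, hpost⟩ :=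
      BETEL.exists_posterior_le hQ hfeas' hΘ₀ hTheta.1 hid (mem_ae_iff.2 hprior) hthick hlam hM hc
    exact ⟨C, hC, K, hK, htypical.mono fun ω hω => hpost.mp (hω.mono fun n hn hle => hle _ hn),
      hpost.mono fun n hn x hx => hn x (hexact n x hx)⟩
  · obtain ⟨K, hK, hpred⟩ := BETEL.exists_tvDist_predictive_le hQ hfeas' hΘ₀ hTheta.1 hid
      (mem_ae_iff.2 hprior) hP hthick hlam hM
    exact ⟨K, hK, htypical.mono fun ω hω => hpred.mp (hω.mono fun n hn hle => hle _ hn),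
      hpred.mono fun n hn x hx => hn x (hexact n x hx)⟩
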